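/- Write $\mathbb R^+=[0,\infty)$. For a positive continuous function $\omega$ on $\mathbb R^+$ let $L^1(\omega)$ be the Banach space of (classes of) measurable functions $f:\mathbb R^+\to\mathbb C$ with $\|f\|=\int_0^\infty|f(t)|\omega(t)\,dt<\infty$; its dual is identified with the space $L^\infty(1/\omega)$ of measurable $h$ with $\operatorname{ess\,sup}|h|/\omega<\infty$ via $\langle f,h\rangle=\int_0^\infty f(t)h(t)\,dt$. Let $C_0(1/\omega)$ be the space of continuous $g:\mathbb R^+\to\mathbb C$ such that $g/\omega$ vanishes at infinity, normed by $\sup|g|/\omega$; its dual is identified with the space $M(\mathbb R^+,\omega)$ of locally finite complex Borel measures $\mu$ on $\mathbb R^+$ with $\|\mu\|=\int_{\mathbb R^+}\omega\,d|\mu|<\infty$ via $\langle g,\mu\rangle=\int_{\mathbb R^+}g\,d\mu$. We regard $L^1(\omega)$ as a subspace of $M(\mathbb R^+,\omega)$ by identifying $f$ with the measure $f(x)\,dx$; $\delta_0$ denotes the unit point mass at $0$. **Proposition.** Let $\psi$ be a non-negative, measurable function on $[0,1]$ and let $\omega_1,\omega_2$ be positive, continuous functions on $\mathbb R^+$. Assume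 condition (C): there is a constant $C$ such that $$\int_0^1\omega_2(s/t)\,\frac{\psi(t)}{t}\,dt\le C\,\omega_1(s)\qquad\text{for every }s\in\mathbb R^+ .$$ Then $(U_\psi f)(x)=\int_0^1f(tx)\psi(t)\,dt$ defines a bounded operator $U_\psi:L^1(\omega_1)\to L^1(\omega_2)$; its adjoint $U_\psi^*:L^\infty(1/\omega_2)\to L^\infty(1/\omega_1)$ restricts to a linear map $V_\psi:C_0(1/\omega_2)\to C_0(1/\omega_1)$; and the adjoint $\overline U_\psi=V_\psi^*$, that is, the unique linear map $\overline U_\psi:M(\mathbb R^+,\omega_1)\to M(\mathbb R^+,\omega_2)$ with $\langle g,\overline U_\psi\mu\rangle=\langle V_\psi g,\mu\rangle$ for all $g\in C_0(1/\omega_2)$ and $\mu\in M(\mathbb R^+,\omega_1)$, is a bounded extension of $U_\psi$. Moreover $$\operatorname{ran}\overline U_\psi\subseteq L^1(\omega_2)\oplus\mathbb C\delta_0,$$ that is, for every $\mu\in M(\mathbb R^+,\omega_1)$ there are a unique $f\in L^1(\omega_2)$ and a unique $c\in\mathbb C$ with $\overline U_\psi\mu=f(x)\,dx+c\,\delta_0$.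 -/

import Mathlib

open MeasureTheory Filter Topology
open scoped NNReal ENNReal

noncomputable section

namespace HardyCesaro

/-! ### The half-line `[0, ∞)`, modelled by `ℝ≥0`, and weights on it -/

/-- Lebesgue measure on the half-line `[0, ∞)`. -/
def lebesgue : Measure ℝ≥0 := (volume : Measure ℝ).comap ((↑) : ℝ≥0 → ℝ)

/-- A weight: a positive continuous function on `[0, ∞)`. -/
structure Weight where
  toFun : ℝ≥0 → ℝ≥0
  continuous' : Continuous toFun
  pos' : ∀ x, 0 < toFun x

instance : CoeFun Weight fun _ => ℝ≥0 → ℝ≥0 := ⟨Weight.toFun⟩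

/-- The weighted space `L¹(ω)` of (classes of) functions with `∫ |f(x)| ω(x) dx < ∞`, that is, the
`L¹` space of the measure `ω(x) dx`. -/
abbrev WeightedL1 (ω : Weight) : Type :=
  Lp ℂ 1 (lebesgue.withDensity fun x => (ω x : ℝ≥0∞))

/-- The space `C₀(1/ω)` of continuous functions `g` on `[0, ∞)` such that `g / ω` vanishes at
infinity. -/
def WeightedC0 (ω : Weight) : Submodule ℂ C(ℝ≥0, ℂ) where
  carrier := {g | Tendsto (fun x => ‖g x‖ / (ω x : ℝ)) (cocompact ℝ≥0) (𝓝 0)}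
  zero_mem' := by simp
  add_mem' := by
    intro f g hf hg
    refine squeeze_zero (fun x => by positivity) (fun x => ?_) (by simpa using hf.add hg)
    rw [← add_div]
    exact div_le_div_of_nonneg_right (norm_add_le _ _) (ω x).2
  smul_mem' := by
    intro c g hg
    simpa [mul_div_assoc] using Tendsto.const_mul ‖c‖ hg

/-! ### Locally finite complex measures -/

/-- The complex-valued functions on the ring of bounded Borel sets of `[0, ∞)` that are countably
additive there. The value at any other set is set to `0`. -/
def locFinMeasures : Submodule ℂ (Set ℝ≥0 → ℂ) where
  carrier := {μ |
    (∀ s, ¬ (MeasurableSet s ∧ Bornology.IsBounded s) → μ s = 0) ∧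
    ∀ f : ℕ → Set ℝ≥0, (∀ i, MeasurableSet (f i)) → Pairwise (Function.onFun Disjoint f) →
      Bornology.IsBounded (⋃ i, f i) → HasSum (fun i => μ (f i)) (μ (⋃ i, f i))}
  zero_mem' := ⟨fun _ _ => rfl, fun _ _ _ _ => hasSum_zero⟩
  add_mem' := by
    rintro μ ν ⟨h1, h2⟩ ⟨h3, h4⟩
    refine ⟨fun s hs => by simp [h1 s hs, h3 s hs], fun f hf hd hb => ?_⟩
    exact (h2 f hf hd hb).add (h4 f hf hd hb)
  smul_mem' := by
    rintro c μ ⟨h1, h2⟩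
    refine ⟨fun s hs => by simp [h1 s hs], fun f hf hd hb => ?_⟩
    exact (h2 f hf hd hb).const_smul c

/-- A locally finite complex Borel measure on `[0, ∞)`. -/
abbrev LocFinMeasure : Type := locFinMeasures

instance : CoeFun LocFinMeasure fun _ => Set ℝ≥0 → ℂ := ⟨fun μ => μ.1⟩

/-- The annulus `[n, n + 1)`; these sets partition `[0, ∞)`. -/
def annulus (n : ℕ) : Set ℝ≥0 := Set.Ico (n : ℝ≥0) (n + 1)

lemma measurableSet_annulus (n : ℕ) : MeasurableSet (annulus n) := measurableSet_Ico

lemma isBounded_annulus (n : ℕ) : Bornology.IsBounded (annulus n) := Metric.isBounded_Ico _ _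

lemma iUnion_annulus : ⋃ n, annulus n = Set.univ := by
  refine Set.eq_univ_of_forall fun x => Set.mem_iUnion.2 ⟨⌊x⌋₊, ?_, ?_⟩
  · exact Nat.floor_le (zero_le)
  · exact Nat.lt_floor_add_one x

lemma pairwise_disjoint_annulus : Pairwise (Function.onFun Disjoint annulus) := by
  intro m n hmn
  refine Set.disjoint_left.2 fun x hm hn => hmn ?_
  have h1 : ⌊x⌋₊ = m := (Nat.floor_eq_iff (zero_le)).2 ⟨hm.1, hm.2⟩
  have h2 : ⌊x⌋₊ = n := (Nat.floor_eq_iff (zero_le)).2 ⟨hn.1, hn.2⟩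
  exact h1.symm.trans h2

namespace LocFinMeasure

open Classical in
/-- The restriction of a locally finite complex measure to `[n, n + 1)`, a complex measure. -/
def piece (μ : LocFinMeasure) (n : ℕ) : ComplexMeasure ℝ≥0 where
  measureOf' s := if MeasurableSet s then μ (s ∩ annulus n) else 0
  empty' := by
    have h := μ.2.2 (fun _ => ∅) (by simp) (by intro i j _; simp [Function.onFun]) (by simp)
    have h' : HasSum (fun _ : ℕ => μ.1 ∅) (μ.1 ∅) := by simpa using h
    have h0 : μ.1 ∅ = 0 := tendsto_nhds_unique tendsto_const_nhds h'.summable.tendsto_atTop_zero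
    simp [h0]
  not_measurable' s hs := by simp [hs]
  m_iUnion' f hf hd := by
    have h := μ.2.2 (fun i => f i ∩ annulus n)
      (fun i => (hf i).inter (measurableSet_annulus n))
      (fun i j hij => (hd hij).mono Set.inter_subset_left Set.inter_subset_left)
      ((isBounded_annulus n).subset (Set.iUnion_subset fun i => Set.inter_subset_right))
    simpa [hf, MeasurableSet.iUnion hf, Set.iUnion_inter] using h

open Classical in
lemma piece_apply (μ : LocFinMeasure) (n : ℕ) {s : Set ℝ≥0} (hs : MeasurableSet s) :
    μ.piece n s = μ (s ∩ annulus n) := by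
  change (if MeasurableSet s then _ else _) = _
  simp [hs]

lemma piece_add (μ ν : LocFinMeasure) (n : ℕ) : (μ + ν).piece n = μ.piece n + ν.piece n := by
  ext s hs
  rw [_root_.add_apply, piece_apply _ _ hs, piece_apply _ _ hs, piece_apply _ _ hs]
  rfl

lemma piece_smul (c : ℂ) (μ : LocFinMeasure) (n : ℕ) : (c • μ).piece n = c • μ.piece n := by
  ext s hs
  rw [_root_.smul_apply, piece_apply _ _ hs, piece_apply _ _ hs]
  rfl

lemma piece_zero (n : ℕ) : (0 : LocFinMeasure).piece n = 0 := by
  ext s hs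
  rw [piece_apply _ _ hs]
  rfl

/-- The total variation `|μ|`, a positive Borel measure on `[0, ∞)`. -/
def variation (μ : LocFinMeasure) : Measure ℝ≥0 :=
  Measure.sum fun n => (μ.piece n).variation

lemma variation_add_le (μ ν : LocFinMeasure) :
    (μ + ν).variation ≤ μ.variation + ν.variation := by
  unfold variation
  rw [Measure.sum_add_sum]
  refine Measure.le_iff.2 fun s hs => ?_
  rw [Measure.sum_apply _ hs, Measure.sum_apply _ hs]
  refine ENNReal.tsum_le_tsum fun n => ?_
  rw [piece_add]
  exact VectorMeasure.variation_add_le s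

lemma variation_smul (c : ℂ) (μ : LocFinMeasure) :
    (c • μ).variation = ‖c‖₊ • μ.variation := by
  unfold variation
  ext s hs
  rw [Measure.smul_apply, Measure.sum_apply _ hs, Measure.sum_apply _ hs]
  simp only [piece_smul, VectorMeasure.variation_smul, Measure.smul_apply]
  simp only [ENNReal.smul_def, smul_eq_mul]
  rw [ENNReal.tsum_mul_left]

lemma variation_zero : (0 : LocFinMeasure).variation = 0 := by
  unfold variation
  simp [piece_zero]

/-- The integral `∫ f dμ`, as the sum of the integrals over the annuli `[n, n + 1)`. (It converges
absolutely if `f` is `|μ|`-integrable, the only case in which it is used.) -/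
def integral (μ : LocFinMeasure) (f : ℝ≥0 → ℂ) : ℂ :=
  ∑' n, VectorMeasure.integral (μ.piece n) f (ContinuousLinearMap.mul ℝ ℂ)

/-- The norm `∫ ω d|μ|`, possibly infinite. -/
def weightedNorm (ω : Weight) (μ : LocFinMeasure) : ℝ≥0∞ := ∫⁻ x, ω x ∂μ.variation

end LocFinMeasure

/-- The space `M(ω)` of locally finite complex Borel measures `μ` with `∫ ω d|μ| < ∞`. -/
def WeightedM (ω : Weight) : Submodule ℂ LocFinMeasure where
  carrier := {μ | μ.weightedNorm ω < ∞}
  zero_mem' := by simp [LocFinMeasure.weightedNorm, LocFinMeasure.variation_zero]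
  add_mem' := by
    intro μ ν hμ hν
    refine lt_of_le_of_lt (lintegral_mono' (LocFinMeasure.variation_add_le μ ν) le_rfl) ?_
    rw [lintegral_add_measure]
    exact ENNReal.add_lt_top.2 ⟨hμ, hν⟩
  smul_mem' := by
    intro c μ hμ
    change LocFinMeasure.weightedNorm _ _ < ∞
    unfold LocFinMeasure.weightedNorm
    rw [LocFinMeasure.variation_smul, lintegral_smul_measure]
    exact ENNReal.mul_lt_top (by simp) hμ

/-- The duality `⟨g, μ⟩ = ∫ g dμ` between `C₀(1/ω)` and `M(ω)`. -/
def pairing {ω : Weight} (g : WeightedC0 ω) (μ : WeightedM ω) : ℂ := μ.1.integral g.1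

/-! ### `L¹(ω)` and `δ₀` inside `M(ω)` -/

lemma measurable_weight (ω : Weight) : Measurable fun x => (ω x : ℝ≥0∞) :=
  ω.continuous'.measurable.coe_nnreal_ennreal

lemma lintegral_weightedL1 {ω : Weight} (f : WeightedL1 ω) :
    ∫⁻ x, ‖f x‖ₑ * ω x ∂lebesgue < ∞ := by
  have h := (memLp_one_iff_integrable.1 (Lp.memLp f)).hasFiniteIntegral
  rw [hasFiniteIntegral_iff_enorm, lintegral_withDensity_eq_lintegral_mul _ (measurable_weight ω)
    (Lp.stronglyMeasurable f).enorm] at h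
  simpa [mul_comm] using h

lemma weightedL1_integrableOn {ω : Weight} (f : WeightedL1 ω) {s : Set ℝ≥0}
    (hb : Bornology.IsBounded s) : IntegrableOn (fun x => f x) s lebesgue := by
  refine ⟨(Lp.stronglyMeasurable f).aestronglyMeasurable, ?_⟩
  rw [hasFiniteIntegral_iff_enorm]
  rcases s.eq_empty_or_nonempty with rfl | hne
  · simp
  obtain ⟨y, -, hy⟩ := hb.isCompact_closure.exists_isMinOn hne.closure ω.continuous'.continuousOn
  have hpos : (ω y : ℝ≥0∞) ≠ 0 := by simpa using (ω.pos' y).ne'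
  have key : ω y * ∫⁻ x in s, ‖f x‖ₑ ∂lebesgue < ∞ := by
    rw [← lintegral_const_mul _ (Lp.stronglyMeasurable f).enorm]
    calc ∫⁻ x in s, ω y * ‖f x‖ₑ ∂lebesgue
        ≤ ∫⁻ x in closure s, ω y * ‖f x‖ₑ ∂lebesgue := lintegral_mono_set subset_closure
      _ ≤ ∫⁻ x in closure s, ‖f x‖ₑ * ω x ∂lebesgue := by
          refine setLIntegral_mono' isClosed_closure.measurableSet fun x hx => ?_
          rw [mul_comm]
          gcongr
          exact hy hx
      _ ≤ ∫⁻ x, ‖f x‖ₑ * ω x ∂lebesgue := setLIntegral_le_lintegral _ _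
      _ < ∞ := lintegral_weightedL1 f
  rcases ENNReal.mul_lt_top_iff.1 key with h | h | h
  · exact h.2
  · exact absurd h hpos
  · rw [h]; exact ENNReal.zero_lt_top

/-- The locally finite measure `f(x) dx` of a function `f` that is integrable on every bounded
set. -/
def densityMeasure (f : ℝ≥0 → ℂ)
    (hf : ∀ s, Bornology.IsBounded s → IntegrableOn f s lebesgue) : LocFinMeasure :=
  open Classical in
  ⟨fun s => if MeasurableSet s ∧ Bornology.IsBounded s then ∫ x in s, f x ∂lebesgue else 0, by
    refine ⟨fun s hs => if_neg hs, fun t ht hd hb => ?_⟩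
    have hbi : ∀ i, Bornology.IsBounded (t i) := fun i => hb.subset (Set.subset_iUnion t i)
    have h := hasSum_integral_iUnion ht hd (hf _ hb)
    simpa [ht, hbi, hb, MeasurableSet.iUnion ht] using h⟩

open Classical in
lemma densityMeasure_apply (f : ℝ≥0 → ℂ)
    (hf : ∀ s, Bornology.IsBounded s → IntegrableOn f s lebesgue) {s : Set ℝ≥0}
    (hs : MeasurableSet s) (hb : Bornology.IsBounded s) :
    densityMeasure f hf s = ∫ x in s, f x ∂lebesgue :=
  if_pos ⟨hs, hb⟩

lemma densityMeasure_variation_le (f : ℝ≥0 → ℂ)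
    (hf : ∀ s, Bornology.IsBounded s → IntegrableOn f s lebesgue) :
    (densityMeasure f hf).variation ≤ lebesgue.withDensity fun x => ‖f x‖ₑ := by
  have hpiece : ∀ n, ((densityMeasure f hf).piece n).variation ≤
      (lebesgue.withDensity fun x => ‖f x‖ₑ).restrict (annulus n) := by
    intro n
    refine VectorMeasure.variation_le_of_forall_enorm_le fun E hE => ?_
    have hm := hE.inter (measurableSet_annulus n)
    rw [LocFinMeasure.piece_apply _ _ hE, Measure.restrict_apply hE, withDensity_apply _ hm,
      densityMeasure_apply f hf hm ((isBounded_annulus n).subset Set.inter_subset_right)]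
    exact enorm_integral_le_lintegral_enorm _
  refine Measure.le_iff.2 fun s hs => ?_
  rw [LocFinMeasure.variation, Measure.sum_apply _ hs]
  refine (ENNReal.tsum_le_tsum fun n => hpiece n s).trans ?_
  rw [← Measure.sum_apply _ hs,
    ← Measure.restrict_iUnion pairwise_disjoint_annulus measurableSet_annulus, iUnion_annulus,
    Measure.restrict_univ]

/-- The inclusion of `L¹(ω)` in `M(ω)`, which takes `f` to the measure `f(x) dx`. -/
def ofL1 {ω : Weight} (f : WeightedL1 ω) : WeightedM ω :=
  ⟨densityMeasure (fun x => f x) fun _ hs => weightedL1_integrableOn f hs, by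
    have hm : Measurable fun x => ‖f x‖ₑ := (Lp.stronglyMeasurable f).enorm
    refine lt_of_le_of_lt (lintegral_mono' (densityMeasure_variation_le _ _) le_rfl) ?_
    rw [lintegral_withDensity_eq_lintegral_mul _ hm (measurable_weight ω)]
    exact lintegral_weightedL1 f⟩

/-- The unit point mass at `0`, as a locally finite measure. -/
def diracZeroMeasure : LocFinMeasure :=
  open Classical in
  ⟨fun s => if MeasurableSet s ∧ Bornology.IsBounded s then s.indicator (fun _ => (1 : ℂ)) 0 else 0,
    by
    refine ⟨fun s hs => if_neg hs, fun t ht hd hb => ?_⟩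
    have hbi : ∀ i, Bornology.IsBounded (t i) := fun i => hb.subset (Set.subset_iUnion t i)
    have h : HasSum (fun i => (t i).indicator (fun _ => (1 : ℂ)) 0)
        ((⋃ i, t i).indicator (fun _ => (1 : ℂ)) 0) := by
      by_cases h0 : (0 : ℝ≥0) ∈ ⋃ i, t i
      · obtain ⟨i, hi⟩ := Set.mem_iUnion.1 h0
        have e := hasSum_single (f := fun j => (t j).indicator (fun _ => (1 : ℂ)) 0) i
          fun j hj => Set.indicator_of_notMem (fun hj0 => Set.disjoint_left.1 (hd hj) hj0 hi) _
        simpa only [Set.indicator_of_mem h0, Set.indicator_of_mem hi] using e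
      · rw [Set.indicator_of_notMem h0]
        have : ∀ i, (t i).indicator (fun _ => (1 : ℂ)) 0 = 0 := fun i =>
          Set.indicator_of_notMem (fun hi => h0 (Set.mem_iUnion.2 ⟨i, hi⟩)) _
        simp [this]
    simpa [ht, hbi, hb, MeasurableSet.iUnion ht] using h⟩

lemma diracZeroMeasure_variation_le : diracZeroMeasure.variation ≤ Measure.dirac 0 := by
  have hpiece : ∀ n, (diracZeroMeasure.piece n).variation ≤
      (Measure.dirac (0 : ℝ≥0)).restrict (annulus n) := by
    intro n
    refine VectorMeasure.variation_le_of_forall_enorm_le fun E hE => ?_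
    have hm := hE.inter (measurableSet_annulus n)
    have hb := (isBounded_annulus n).subset (Set.inter_subset_right (s := E))
    rw [LocFinMeasure.piece_apply _ _ hE, Measure.restrict_apply hE, Measure.dirac_apply' _ hm]
    have : diracZeroMeasure (E ∩ annulus n) = (E ∩ annulus n).indicator (fun _ => (1 : ℂ)) 0 :=
      if_pos ⟨hm, hb⟩
    rw [this]
    by_cases h0 : (0 : ℝ≥0) ∈ E ∩ annulus n
    · simp [Set.indicator_of_mem h0]
    · simp [Set.indicator_of_notMem h0]
  refine Measure.le_iff.2 fun s hs => ?_
  rw [LocFinMeasure.variation, Measure.sum_apply _ hs]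
  refine (ENNReal.tsum_le_tsum fun n => hpiece n s).trans ?_
  rw [← Measure.sum_apply _ hs,
    ← Measure.restrict_iUnion pairwise_disjoint_annulus measurableSet_annulus, iUnion_annulus,
    Measure.restrict_univ]

/-- The point mass `δ₀` as an element of `M(ω)`. -/
def diracZero (ω : Weight) : WeightedM ω :=
  ⟨diracZeroMeasure, by
    refine lt_of_le_of_lt (lintegral_mono' diracZeroMeasure_variation_le le_rfl) ?_
    rw [lintegral_dirac' _ (measurable_weight ω)]
    exact ENNReal.coe_lt_top⟩

/-! ### The operators -/

open unitInterval in
/-- Condition (C): `∫₀¹ ω₂(s/t) ψ(t)/t dt ≤ C ω₁(s)` for all `s ≥ 0`, for some constant `C`. -/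
def ConditionC (ψ : unitInterval → ℝ≥0) (ω₁ ω₂ : Weight) : Prop :=
  ∃ C : ℝ≥0, ∀ s : ℝ≥0,
    ∫⁻ t : unitInterval, ((ω₂ (s / toNNReal t) * (ψ t / toNNReal t) : ℝ≥0) : ℝ≥0∞)
      ≤ C * ω₁ s

open unitInterval in
/-- `U` is the generalized Hardy-Cesàro operator `(U_ψ f)(x) = ∫₀¹ f(tx) ψ(t) dt`, as a bounded
operator from `L¹(ω₁)` to `L¹(ω₂)`. -/
def IsHardyCesaro {ω₁ ω₂ : Weight} (ψ : unitInterval → ℝ≥0)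
    (U : WeightedL1 ω₁ →L[ℂ] WeightedL1 ω₂) : Prop :=
  ∀ f : WeightedL1 ω₁, ∀ᵐ x ∂lebesgue,
    Integrable (fun t : unitInterval => f (toNNReal t * x) * ((ψ t : ℝ) : ℂ)) ∧
    U f x = ∫ t : unitInterval, f (toNNReal t * x) * ((ψ t : ℝ) : ℂ)

/-- `V : C₀(1/ω₂) → C₀(1/ω₁)` is the restriction to `C₀(1/ω₂)` of the Banach space adjoint of
`U : L¹(ω₁) → L¹(ω₂)`, where the dual of `L¹(ω)` is identified with `L^∞(1/ω)` through
`⟨f, h⟩ = ∫ f(x) h(x) dx`. -/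
def IsRestrictedAdjoint {ω₁ ω₂ : Weight} (U : WeightedL1 ω₁ →L[ℂ] WeightedL1 ω₂)
    (V : WeightedC0 ω₂ →ₗ[ℂ] WeightedC0 ω₁) : Prop :=
  ∀ (f : WeightedL1 ω₁) (g : WeightedC0 ω₂),
    ∫ x, U f x * g.1 x ∂lebesgue = ∫ x, f x * (V g).1 x ∂lebesgue

/-- `W : M(ω₁) → M(ω₂)` is the adjoint of `V : C₀(1/ω₂) → C₀(1/ω₁)`, where the dual of `C₀(1/ω)`
is identified with `M(ω)` through `⟨g, μ⟩ = ∫ g dμ`. -/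
def IsMeasureAdjoint {ω₁ ω₂ : Weight} (V : WeightedC0 ω₂ →ₗ[ℂ] WeightedC0 ω₁)
    (W : WeightedM ω₁ →ₗ[ℂ] WeightedM ω₂) : Prop :=
  ∀ (g : WeightedC0 ω₂) (μ : WeightedM ω₁), pairing g (W μ) = pairing (V g) μ

/-- `W : M(ω₁) → M(ω₂)` is the operator `Ū_ψ = V_ψ*`, where `V_ψ` is the restriction of `U_ψ*` to
`C₀(1/ω₂)`. -/
def IsMeasureExtension {ω₁ ω₂ : Weight} (ψ : unitInterval → ℝ≥0)
    (W : WeightedM ω₁ →ₗ[ℂ] WeightedM ω₂) : Prop :=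
  ∃ (U : WeightedL1 ω₁ →L[ℂ] WeightedL1 ω₂) (V : WeightedC0 ω₂ →ₗ[ℂ] WeightedC0 ω₁),
    IsHardyCesaro ψ U ∧ IsRestrictedAdjoint U V ∧ IsMeasureAdjoint V W

end HardyCesaro

end

open MeasureTheory Filter Topology
open scoped NNReal ENNReal

noncomputable section

namespace HardyCesaro

variable {ψ : unitInterval → ℝ≥0} {ω₁ ω₂ : Weight} {C : ℝ≥0}

/-! ### Integrals against complex measures -/

/-! Substituting $s=tx$ in $\int (U_\psi f)\,g$ gives the adjoint explicitly: $(V_\psi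
g)(s)=\int_0^1 g(s/t)\,\psi(t)/t\,dt$. All estimates are therefore about the measure $\psi(t)/t\,dt$
on $[0,1]$ (`dilationMeasure`), and condition (C) says that integrating $\omega_2(s/t)$ against it
costs at most $C\omega_1(s)$. By Tonelli this bounds $U_\psi$ (`lintegral_hardyFun_le`). It also
bounds $V_\psi$ in the weighted sup norms (`norm_adjointFun_le`), so $V_\psi g$ is a limit, in the
norm of $C_0(1/\omega_1)$, of images of compactly supported functions, which are continuous and
vanish near infinity (`exists_adjointFun_approx`).

For a positive measure $m$, Fubini identifies $V_\psi^*m$ with the image of $m\otimes\psi(t)/t\,dt$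
under $(s,t)\mapsto s/t$ (`integral_dilated`). The point $s=0$ is fixed by every dilation and yields
a multiple of $\delta_0$ (`dilated_eq_add`). For $s>0$ the map $t\mapsto s/t$ pulls Lebesgue null
sets back to null sets (`dilationMeasure_preimage_eq_zero`), so the rest of $m$ has an absolutely
continuous image, whose Radon–Nikodym density lies in $L^1(\omega_2)$ (`positiveM_eq_ofL1_add`). A
general $\mu$ is a combination of four positive measures with coefficients $1,i,-1,-i$
(`eq_sum_positiveM`).

Uniqueness is two separation arguments: integrals against $L^1(\omega)$ determine an element of
$C_0(1/\omega)$ (`weightedC0_ext_of_integral`), and pairings with $C_0(1/\omega)$ determine an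
element of $M(\omega)$ (`eq_of_forall_pairing_eq`). The latter also yields the linearity of
$\overline U_\psi$ and the fact that it extends $U_\psi$. -/

/-- The integral comes from a real bilinear map, so homogeneity in a complex scalar needs an
argument. Both sides extend the set function $s\mapsto c\,\mu(s)$, but relative to $|c\mu|$ and
$|\mu|$; since $|c\mu|\le|c||\mu|$, the first can be computed relative to $|\mu|$. -/
lemma integral_const_smul_complexMeasure {X : Type*} [MeasurableSpace X] (c : ℂ)
    (μ : ComplexMeasure X) {f : X → ℂ} (hf : μ.Integrable f) :
    VectorMeasure.integral (c • μ) f (ContinuousLinearMap.mul ℝ ℂ) =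
      c * VectorMeasure.integral μ f (ContinuousLinearMap.mul ℝ ℂ) := by
  have h := VectorMeasure.continuousLinearMap_apply_integral (B := ContinuousLinearMap.mul ℝ ℂ)
    (C := ContinuousLinearMap.mul ℝ ℂ c) hf
  rw [ContinuousLinearMap.mul_apply'] at h
  rw [h, VectorMeasure.integral_eq_setToFun, VectorMeasure.integral_eq_setToFun]
  have hle : (c • μ).variation ≤ (‖c‖₊ : ℝ≥0∞) • μ.variation := by
    rw [VectorMeasure.variation_smul]; rfl
  have hT : DominatedFinMeasAdditive μ.variation
      ((c • μ).transpose (ContinuousLinearMap.mul ℝ ℂ))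
      (((‖c‖₊ : ℝ≥0∞).toReal * ‖ContinuousLinearMap.mul ℝ ℂ‖)) :=
    (dominatedFinMeasAdditive_cbmApplyMeasure (c • μ) _).of_measure_le_smul (by simp) hle
      (ContinuousLinearMap.opNorm_nonneg _)
  rw [← setToFun_congr_measure_of_integrable _ (by simp) hle hT _ f hf]
  refine setToFun_congr_left' _ _ (fun s _ _ => ContinuousLinearMap.ext fun x => ?_) _
  change x * (c • μ) s = c * (x * μ s)
  rw [_root_.smul_apply, smul_eq_mul]
  ring

/-- Since $|\mu|\le m$, the vector-measure integral may be formed relative to $m$, where it has the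
same set function as the Bochner integral. -/
lemma integral_ofReal_measure {X : Type*} [MeasurableSpace X] {m : Measure X} [IsFiniteMeasure m]
    {μ : ComplexMeasure X} (h : ∀ s, MeasurableSet s → μ s = (m.real s : ℂ)) (f : X → ℂ)
    (hf : Integrable f m) :
    VectorMeasure.integral μ f (ContinuousLinearMap.mul ℝ ℂ) = ∫ x, f x ∂m := by
  have hle : μ.variation ≤ (1 : ℝ≥0∞) • m := by
    rw [one_smul]
    refine VectorMeasure.variation_le_of_forall_enorm_le fun E hE => ?_
    rw [h E hE, ← ofReal_norm, Complex.norm_real, Real.norm_of_nonneg measureReal_nonneg,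
      ofReal_measureReal]
  have hT : DominatedFinMeasAdditive m (μ.transpose (ContinuousLinearMap.mul ℝ ℂ))
      ‖ContinuousLinearMap.mul ℝ ℂ‖ := by
    exact (dominatedFinMeasAdditive_cbmApplyMeasure μ _).of_measure_le (by simpa using hle)
      (ContinuousLinearMap.opNorm_nonneg _)
  rw [VectorMeasure.integral_eq_setToFun, MeasureTheory.integral_eq_setToFun,
    ← setToFun_congr_measure_of_integrable _ (by simp) hle hT _ f hf]
  refine setToFun_congr_left' _ _ (fun s hs _ => ?_) _
  ext
  simp [VectorMeasure.transpose, h s hs, weightedSMul]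

namespace LocFinMeasure

lemma piece_integrable (μ : LocFinMeasure) {f : ℝ≥0 → ℂ} (hf : Integrable f μ.variation) (n : ℕ) :
    (μ.piece n).Integrable f :=
  hf.mono_measure (Measure.le_sum _ n)

lemma summable_integral_piece (μ : LocFinMeasure) {f : ℝ≥0 → ℂ} (hf : Integrable f μ.variation) :
    Summable fun n => VectorMeasure.integral (μ.piece n) f (ContinuousLinearMap.mul ℝ ℂ) := by
  have h := (hasSum_integral_measure (f := fun x => ‖f x‖) hf.norm).summable
  refine Summable.of_norm_bounded (h.mul_left ‖ContinuousLinearMap.mul ℝ ℂ‖) fun n => ?_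
  exact VectorMeasure.norm_integral_le_integral_norm

lemma integral_add (μ ν : LocFinMeasure) {f : ℝ≥0 → ℂ} (hμ : Integrable f μ.variation)
    (hν : Integrable f ν.variation) :
    (μ + ν).integral f = μ.integral f + ν.integral f := by
  unfold integral
  rw [← (summable_integral_piece μ hμ).tsum_add (summable_integral_piece ν hν)]
  refine tsum_congr fun n => ?_
  rw [piece_add, VectorMeasure.integral_add_vectorMeasure (piece_integrable μ hμ n)
    (piece_integrable ν hν n)]

lemma integral_smul (c : ℂ) (μ : LocFinMeasure) {f : ℝ≥0 → ℂ} (hμ : Integrable f μ.variation) :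
    (c • μ).integral f = c * μ.integral f := by
  unfold integral
  rw [← tsum_mul_left]
  refine tsum_congr fun n => ?_
  rw [piece_smul, integral_const_smul_complexMeasure c _ (piece_integrable μ hμ n)]

lemma ext_bounded {μ ν : LocFinMeasure}
    (h : ∀ s, MeasurableSet s → Bornology.IsBounded s → μ s = ν s) : μ = ν := by
  refine Subtype.ext (funext fun s => ?_)
  by_cases hs : MeasurableSet s ∧ Bornology.IsBounded s
  · exact h s hs.1 hs.2
  · rw [μ.2.1 s hs, ν.2.1 s hs]

lemma weightedNorm_add_le (ω : Weight) (μ ν : LocFinMeasure) :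
    (μ + ν).weightedNorm ω ≤ μ.weightedNorm ω + ν.weightedNorm ω := by
  refine (lintegral_mono' (variation_add_le μ ν) le_rfl).trans ?_
  rw [lintegral_add_measure]
  rfl

lemma weightedNorm_smul (ω : Weight) (c : ℂ) (μ : LocFinMeasure) :
    (c • μ).weightedNorm ω = ‖c‖₊ * μ.weightedNorm ω := by
  unfold weightedNorm
  rw [variation_smul, lintegral_smul_measure]
  rfl

end LocFinMeasure

/-! ### Positive measures -/

/-- The weight has a positive minimum on the compact closure of a bounded set. -/
lemma measure_ne_top_of_isBounded {ω : Weight} {m : Measure ℝ≥0} (hm : ∫⁻ x, ω x ∂m < ∞)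
    {s : Set ℝ≥0} (hb : Bornology.IsBounded s) : m s ≠ ∞ := by
  rcases s.eq_empty_or_nonempty with rfl | hne
  · simp
  obtain ⟨y, -, hy⟩ := hb.isCompact_closure.exists_isMinOn hne.closure ω.continuous'.continuousOn
  have hpos : (ω y : ℝ≥0∞) ≠ 0 := by simpa using (ω.pos' y).ne'
  have key : ω y * m s < ∞ := by
    calc ω y * m s ≤ ω y * m (closure s) := by gcongr; exact subset_closure
      _ = ∫⁻ _ in closure s, ω y ∂m := by rw [setLIntegral_const]
      _ ≤ ∫⁻ x in closure s, ω x ∂m := by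
          refine setLIntegral_mono' isClosed_closure.measurableSet fun x hx => ?_
          exact_mod_cast hy hx
      _ ≤ ∫⁻ x, ω x ∂m := setLIntegral_le_lintegral _ _
      _ < ∞ := hm
  rcases ENNReal.mul_lt_top_iff.1 key with h | h | h
  · exact h.2.ne
  · exact absurd h hpos
  · simp [h]

/-- The locally finite complex measure given by a positive measure that is finite on every bounded
set. -/
def ofMeasure (m : Measure ℝ≥0) (hm : ∀ s, Bornology.IsBounded s → m s ≠ ∞) : LocFinMeasure :=
  open Classical in
  ⟨fun s => if MeasurableSet s ∧ Bornology.IsBounded s then (m.real s : ℂ) else 0, by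
    refine ⟨fun s hs => if_neg hs, fun t ht hd hb => ?_⟩
    have hbi : ∀ i, Bornology.IsBounded (t i) := fun i => hb.subset (Set.subset_iUnion t i)
    have h : HasSum (fun i => m.real (t i)) (m.real (⋃ i, t i)) := by
      rw [Measure.real, measure_iUnion hd ht, ENNReal.tsum_toReal_eq fun i => hm _ (hbi i)]
      exact ENNReal.hasSum_toReal (by rw [← measure_iUnion hd ht]; exact hm _ hb)
    simpa [ht, hbi, hb, MeasurableSet.iUnion ht] using (Complex.hasSum_ofReal.2 h)⟩

lemma ofMeasure_apply {m : Measure ℝ≥0} (hm : ∀ s, Bornology.IsBounded s → m s ≠ ∞)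
    {s : Set ℝ≥0} (hs : MeasurableSet s) (hb : Bornology.IsBounded s) :
    ofMeasure m hm s = (m.real s : ℂ) :=
  if_pos ⟨hs, hb⟩

lemma ofMeasure_piece_apply {m : Measure ℝ≥0} (hm : ∀ s, Bornology.IsBounded s → m s ≠ ∞)
    (n : ℕ) {s : Set ℝ≥0} (hs : MeasurableSet s) :
    (ofMeasure m hm).piece n s = ((m.restrict (annulus n)).real s : ℂ) := by
  rw [LocFinMeasure.piece_apply _ _ hs, ofMeasure_apply hm (hs.inter (measurableSet_annulus n))
    ((isBounded_annulus n).subset Set.inter_subset_right), measureReal_restrict_apply hs]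

lemma sum_restrict_annulus (m : Measure ℝ≥0) :
    Measure.sum (fun n => m.restrict (annulus n)) = m := by
  rw [← Measure.restrict_iUnion pairwise_disjoint_annulus measurableSet_annulus, iUnion_annulus,
    Measure.restrict_univ]

lemma isFiniteMeasure_restrict_annulus {m : Measure ℝ≥0}
    (hm : ∀ s, Bornology.IsBounded s → m s ≠ ∞) (n : ℕ) :
    IsFiniteMeasure (m.restrict (annulus n)) :=
  ⟨by rw [Measure.restrict_apply_univ]; exact (hm _ (isBounded_annulus n)).lt_top⟩

lemma ofMeasure_variation_le {m : Measure ℝ≥0} (hm : ∀ s, Bornology.IsBounded s → m s ≠ ∞) :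
    (ofMeasure m hm).variation ≤ m := by
  have hpiece : ∀ n, ((ofMeasure m hm).piece n).variation ≤ m.restrict (annulus n) := by
    intro n
    have := isFiniteMeasure_restrict_annulus hm n
    refine VectorMeasure.variation_le_of_forall_enorm_le fun E hE => ?_
    rw [ofMeasure_piece_apply hm n hE]
    simp [Measure.real, ← ofReal_norm, ENNReal.ofReal_toReal]
  calc (ofMeasure m hm).variation ≤ Measure.sum (fun n => m.restrict (annulus n)) :=
        Measure.le_iff.2 fun s hs => by
          rw [LocFinMeasure.variation, Measure.sum_apply _ hs, Measure.sum_apply _ hs]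
          exact ENNReal.tsum_le_tsum fun n => hpiece n s
    _ = m := sum_restrict_annulus m

lemma integral_ofMeasure {m : Measure ℝ≥0} (hm : ∀ s, Bornology.IsBounded s → m s ≠ ∞)
    {f : ℝ≥0 → ℂ} (hf : Integrable f m) : (ofMeasure m hm).integral f = ∫ x, f x ∂m := by
  have h := hasSum_integral_measure (f := f) (μ := fun n => m.restrict (annulus n))
    (by rwa [sum_restrict_annulus])
  rw [sum_restrict_annulus] at h
  rw [← h.tsum_eq]
  refine tsum_congr fun n => ?_
  have := isFiniteMeasure_restrict_annulus hm n
  exact integral_ofReal_measure (fun s hs => ofMeasure_piece_apply hm n hs) f hf.restrict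

/-- A positive measure `m` with `∫ ω dm < ∞`, as an element of `M(ω)`. -/
def positiveM {ω : Weight} (m : Measure ℝ≥0) (hm : ∫⁻ x, ω x ∂m < ∞) : WeightedM ω :=
  ⟨ofMeasure m fun _ hs => measure_ne_top_of_isBounded hm hs,
    lt_of_le_of_lt (lintegral_mono' (ofMeasure_variation_le _) le_rfl) hm⟩

lemma positiveM_apply {ω : Weight} {m : Measure ℝ≥0} (hm : ∫⁻ x, ω x ∂m < ∞) {s : Set ℝ≥0}
    (hs : MeasurableSet s) (hb : Bornology.IsBounded s) :
    (positiveM m hm).1 s = (m.real s : ℂ) :=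
  ofMeasure_apply (fun _ hs => measure_ne_top_of_isBounded hm hs) hs hb

lemma weightedNorm_positiveM_le {ω : Weight} {m : Measure ℝ≥0} (hm : ∫⁻ x, ω x ∂m < ∞) :
    (positiveM m hm).1.weightedNorm ω ≤ ∫⁻ x, ω x ∂m :=
  lintegral_mono' (ofMeasure_variation_le fun _ hs => measure_ne_top_of_isBounded hm hs) le_rfl

/-! ### The pairing and the decomposition into positive measures -/

lemma exists_norm_le_mul_weight {ω : Weight} (g : WeightedC0 ω) :
    ∃ K : ℝ≥0, ∀ x, ‖g.1 x‖ ≤ K * ω x := by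
  let h : ZeroAtInftyContinuousMap ℝ≥0 ℝ :=
    { toFun := fun x => ‖g.1 x‖ / (ω x : ℝ)
      continuous_toFun := g.1.continuous.norm.div
        (NNReal.continuous_coe.comp ω.continuous') fun x => by
          simpa using (ω.pos' x).ne'
      zero_at_infty' := g.2 }
  have hK := h.toBCF.norm_coe_le_norm
  set K := ‖h.toBCF‖
  have hK0 : 0 ≤ K := norm_nonneg _
  refine ⟨⟨K, hK0⟩, fun x => ?_⟩
  have hx : (0 : ℝ) < ω x := ω.pos' x
  have : ‖‖g.1 x‖ / (ω x : ℝ)‖ ≤ K := hK x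
  rw [Real.norm_eq_abs] at this
  exact (div_le_iff₀ hx).1 ((le_abs_self _).trans this)

lemma integrable_of_norm_le_weight {ω : Weight} {m : Measure ℝ≥0} (hm : ∫⁻ x, ω x ∂m < ∞)
    {f : ℝ≥0 → ℂ} (hf : AEStronglyMeasurable f m) {K : ℝ≥0} (hK : ∀ x, ‖f x‖ ≤ K * ω x) :
    Integrable f m := by
  refine ⟨hf, ?_⟩
  rw [hasFiniteIntegral_iff_enorm]
  calc ∫⁻ x, ‖f x‖ₑ ∂m ≤ ∫⁻ x, K * ω x ∂m := by
        refine lintegral_mono fun x => ?_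
        have : ‖f x‖₊ ≤ K * ω x := hK x
        rw [enorm_eq_nnnorm, ← ENNReal.coe_mul]
        exact ENNReal.coe_le_coe.2 this
    _ = K * ∫⁻ x, ω x ∂m := lintegral_const_mul _ (measurable_weight ω)
    _ < ∞ := ENNReal.mul_lt_top ENNReal.coe_lt_top hm

lemma integrable_weightedC0 {ω : Weight} (g : WeightedC0 ω) {m : Measure ℝ≥0}
    (hm : ∫⁻ x, ω x ∂m < ∞) : Integrable g.1 m := by
  obtain ⟨K, hK⟩ := exists_norm_le_mul_weight g
  exact integrable_of_norm_le_weight hm g.1.continuous.aestronglyMeasurable hK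

/-- The functional `μ ↦ ⟨g, μ⟩` on `M(ω)`. -/
def pairingLinearMap {ω : Weight} (g : WeightedC0 ω) : WeightedM ω →ₗ[ℂ] ℂ where
  toFun := pairing g
  map_add' μ ν := LocFinMeasure.integral_add μ.1 ν.1 (integrable_weightedC0 g μ.2)
    (integrable_weightedC0 g ν.2)
  map_smul' c μ := LocFinMeasure.integral_smul c μ.1 (integrable_weightedC0 g μ.2)

lemma pairing_positiveM {ω : Weight} (g : WeightedC0 ω) {m : Measure ℝ≥0}
    (hm : ∫⁻ x, ω x ∂m < ∞) : pairing g (positiveM m hm) = ∫ x, g.1 x ∂m :=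
  integral_ofMeasure (fun _ hs => measure_ne_top_of_isBounded hm hs) (integrable_weightedC0 g hm)

lemma pairing_sum {ω : Weight} (g : WeightedC0 ω) {ι : Type*} (s : Finset ι) (c : ι → ℂ)
    (μ : ι → WeightedM ω) : pairing g (∑ i ∈ s, c i • μ i) = ∑ i ∈ s, c i * pairing g (μ i) := by
  refine (map_sum (pairingLinearMap g) (fun i => c i • μ i) s).trans ?_
  exact Finset.sum_congr rfl fun i _ => map_smul (pairingLinearMap g) (c i) (μ i)

lemma weightedM_sum_apply {ω : Weight} {ι : Type*} (t : Finset ι) (c : ι → ℂ)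
    (μ : ι → WeightedM ω) (s : Set ℝ≥0) :
    (∑ i ∈ t, c i • μ i).1 s = ∑ i ∈ t, c i * (μ i).1 s := by
  let e : WeightedM ω →ₗ[ℂ] ℂ :=
    { toFun := fun ν => ν.1 s
      map_add' := fun _ _ => rfl
      map_smul' := fun _ _ => rfl }
  exact (map_sum e (fun i => c i • μ i) t).trans (by simp [e])

lemma weightedNorm_sum_le {ω : Weight} {ι : Type*} (t : Finset ι) (c : ι → ℂ)
    (hc : ∀ i, ‖c i‖₊ = 1) (μ : ι → WeightedM ω) :
    (∑ i ∈ t, c i • μ i).1.weightedNorm ω ≤ ∑ i ∈ t, (μ i).1.weightedNorm ω := by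
  classical
  induction t using Finset.induction_on with
  | empty => simp [LocFinMeasure.weightedNorm, LocFinMeasure.variation_zero]
  | insert i t hi ih =>
    rw [Finset.sum_insert hi, Finset.sum_insert hi]
    refine (LocFinMeasure.weightedNorm_add_le ω _ _).trans (add_le_add ?_ ih)
    change (c i • (μ i).1).weightedNorm ω ≤ _
    rw [LocFinMeasure.weightedNorm_smul, hc]
    simp

/-! ### Decomposition into four positive measures, and separation by $C_0(1/\omega)$ -/

namespace LocFinMeasure

/-- The positive and negative parts of the real and imaginary parts of `μ`, in the order of their
coefficients `1, I, -1, -I`. -/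
def part (μ : LocFinMeasure) (i : Fin 4) : Measure ℝ≥0 :=
  Measure.sum fun n => ![
    (ComplexMeasure.re (μ.piece n)).toJordanDecomposition.posPart,
    (ComplexMeasure.im (μ.piece n)).toJordanDecomposition.posPart,
    (ComplexMeasure.re (μ.piece n)).toJordanDecomposition.negPart,
    (ComplexMeasure.im (μ.piece n)).toJordanDecomposition.negPart] i

/-- Each Jordan part is at most the total variation of the real or imaginary part, which is at most
$|\mu|$ because $|\operatorname{Re}z|,|\operatorname{Im}z|\le|z|$. Hence each part inherits the
weighted finiteness of $\mu$. -/
lemma part_le_variation (μ : LocFinMeasure) (i : Fin 4) : μ.part i ≤ μ.variation := by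
  have hre : ∀ n, (ComplexMeasure.re (μ.piece n)).totalVariation ≤ (μ.piece n).variation := by
    intro n
    rw [SignedMeasure.totalVariation_eq_variation]
    refine VectorMeasure.variation_le_of_forall_enorm_le fun E _ =>
      le_trans ?_ (VectorMeasure.enorm_measure_le_variation _ _)
    rw [enorm_le_iff_norm_le]
    exact Complex.abs_re_le_norm _
  have him : ∀ n, (ComplexMeasure.im (μ.piece n)).totalVariation ≤ (μ.piece n).variation := by
    intro n
    rw [SignedMeasure.totalVariation_eq_variation]
    refine VectorMeasure.variation_le_of_forall_enorm_le fun E _ =>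
      le_trans ?_ (VectorMeasure.enorm_measure_le_variation _ _)
    rw [enorm_le_iff_norm_le]
    exact Complex.abs_im_le_norm _
  refine Measure.le_iff.2 fun s hs => ?_
  rw [part, variation, Measure.sum_apply _ hs, Measure.sum_apply _ hs]
  refine ENNReal.tsum_le_tsum fun n => ?_
  fin_cases i
  · exact ((Measure.le_add_right le_rfl : _ ≤ SignedMeasure.totalVariation _).trans (hre n)) s
  · exact ((Measure.le_add_right le_rfl : _ ≤ SignedMeasure.totalVariation _).trans (him n)) s
  · exact ((Measure.le_add_left le_rfl : _ ≤ SignedMeasure.totalVariation _).trans (hre n)) s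
  · exact ((Measure.le_add_left le_rfl : _ ≤ SignedMeasure.totalVariation _).trans (him n)) s

lemma hasSum_piece (μ : LocFinMeasure) {s : Set ℝ≥0} (hs : MeasurableSet s)
    (hb : Bornology.IsBounded s) : HasSum (fun n => μ.piece n s) (μ s) := by
  have h := μ.2.2 (fun n => s ∩ annulus n) (fun n => hs.inter (measurableSet_annulus n))
    (fun i j hij => (pairwise_disjoint_annulus hij).mono Set.inter_subset_right
      Set.inter_subset_right)
    (hb.subset (Set.iUnion_subset fun i => Set.inter_subset_left))
  rw [← Set.inter_iUnion, iUnion_annulus, Set.inter_univ] at h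
  simpa only [piece_apply _ _ hs] using h

/-- Finiteness is required because `Measure.real` sends infinite mass to $0$; it also allows the
Jordan decompositions on the annuli to be summed. -/
lemma apply_eq_sum_part (μ : LocFinMeasure) {s : Set ℝ≥0} (hs : MeasurableSet s)
    (hb : Bornology.IsBounded s) (hfin : ∀ i, μ.part i s ≠ ∞) :
    μ s = ∑ i : Fin 4, Complex.I ^ (i : ℕ) * ((μ.part i).real s : ℂ) := by
  refine (hasSum_piece μ hs hb).unique ?_
  have h : ∀ i : Fin 4, HasSum (fun n => ((![
      (ComplexMeasure.re (μ.piece n)).toJordanDecomposition.posPart,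
      (ComplexMeasure.im (μ.piece n)).toJordanDecomposition.posPart,
      (ComplexMeasure.re (μ.piece n)).toJordanDecomposition.negPart,
      (ComplexMeasure.im (μ.piece n)).toJordanDecomposition.negPart] i).real s : ℂ))
      ((μ.part i).real s : ℂ) := by
    intro i
    have hi := hfin i
    rw [part, Measure.sum_apply _ hs] at hi
    rw [Complex.hasSum_ofReal, part, Measure.real, Measure.sum_apply _ hs,
      ENNReal.tsum_toReal_eq fun n => ENNReal.ne_top_of_tsum_ne_top hi n]
    exact ENNReal.hasSum_toReal hi
  refine (hasSum_sum fun i (_ : i ∈ Finset.univ) => (h i).mul_left (Complex.I ^ (i : ℕ))).congr_fun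
    fun n => ?_
  rw [Fin.sum_univ_four]
  have hre := (ComplexMeasure.re (μ.piece n)).apply_eq_posPart_real_sub_negPart_real hs
  have him := (ComplexMeasure.im (μ.piece n)).apply_eq_posPart_real_sub_negPart_real hs
  have hre' : ComplexMeasure.re (μ.piece n) s = (μ.piece n s).re := rfl
  have him' : ComplexMeasure.im (μ.piece n) s = (μ.piece n s).im := rfl
  rw [hre'] at hre
  rw [him'] at him
  apply Complex.ext
  · simp [hre, pow_succ]
    ring
  · simp [him, pow_succ]
    ring

end LocFinMeasure

lemma lintegral_part_lt_top {ω : Weight} (μ : WeightedM ω) (i : Fin 4) :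
    ∫⁻ x, ω x ∂μ.1.part i < ∞ :=
  lt_of_le_of_lt (lintegral_mono' (μ.1.part_le_variation i) le_rfl) μ.2

lemma eq_sum_positiveM {ω : Weight} (μ : WeightedM ω) :
    μ = ∑ i : Fin 4, Complex.I ^ (i : ℕ) • positiveM (μ.1.part i) (lintegral_part_lt_top μ i) := by
  refine Subtype.ext (LocFinMeasure.ext_bounded fun s hs hb => ?_)
  rw [weightedM_sum_apply, LocFinMeasure.apply_eq_sum_part μ.1 hs hb fun i =>
    measure_ne_top_of_isBounded (lintegral_part_lt_top μ i) hb]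
  simp only [positiveM_apply _ hs hb]

/-- A compactly supported real function as an element of `C₀(1/ω)`. -/
def compactlySupportedC0 (ω : Weight) (f : CompactlySupportedContinuousMap ℝ≥0 ℝ) :
    WeightedC0 ω :=
  ⟨⟨fun x => (f x : ℂ), Complex.continuous_ofReal.comp f.continuous⟩, by
    refine (tendsto_const_nhds (x := (0 : ℝ))).congr' ?_
    filter_upwards [f.hasCompactSupport.compl_mem_cocompact] with x hx
    simp [image_eq_zero_of_notMem_tsupport hx]⟩

/-- This is the uniqueness half of the Riesz representation theorem; the weighted bounds make both
measures finite on compact sets. -/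
lemma eq_of_forall_integral_compactlySupported {ω : Weight} {m₁ m₂ : Measure ℝ≥0}
    (h₁ : ∫⁻ x, ω x ∂m₁ < ∞) (h₂ : ∫⁻ x, ω x ∂m₂ < ∞)
    (h : ∀ f : CompactlySupportedContinuousMap ℝ≥0 ℝ, ∫ x, f x ∂m₁ = ∫ x, f x ∂m₂) :
    m₁ = m₂ := by
  have : IsFiniteMeasureOnCompacts m₁ :=
    ⟨fun K hK => (measure_ne_top_of_isBounded h₁ hK.isBounded).lt_top⟩
  have : IsFiniteMeasureOnCompacts m₂ :=
    ⟨fun K hK => (measure_ne_top_of_isBounded h₂ hK.isBounded).lt_top⟩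
  exact Measure.ext_of_integral_eq_on_compactlySupported h

lemma eq_zero_of_forall_pairing_eq_zero {ω : Weight} {μ : WeightedM ω}
    (h : ∀ g : WeightedC0 ω, pairing g μ = 0) : μ = 0 := by
  have hm := lintegral_part_lt_top μ
  have key : ∀ f : CompactlySupportedContinuousMap ℝ≥0 ℝ,
      ∫ x, f x ∂μ.1.part 0 = ∫ x, f x ∂μ.1.part 2 ∧
        ∫ x, f x ∂μ.1.part 1 = ∫ x, f x ∂μ.1.part 3 := by
    intro f
    have hf := h (compactlySupportedC0 ω f)
    -- Against a real test function the pairing has real part $\int f\,dm_0-\int f\,dm_2$ and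
    -- imaginary part $\int f\,dm_1-\int f\,dm_3$, so both differences vanish.
    rw [eq_sum_positiveM μ, pairing_sum] at hf
    simp only [pairing_positiveM] at hf
    have e : ∀ m : Measure ℝ≥0,
        ∫ x, (compactlySupportedC0 ω f).1 x ∂m = ((∫ x, f x ∂m : ℝ) : ℂ) :=
      fun m => integral_ofReal
    simp only [e, Fin.sum_univ_four] at hf
    have hre := congrArg Complex.re hf
    have him := congrArg Complex.im hf
    simp [pow_succ] at hre him
    constructor <;> linarith
  have h02 := eq_of_forall_integral_compactlySupported (hm 0) (hm 2) fun f => (key f).1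
  have h13 := eq_of_forall_integral_compactlySupported (hm 1) (hm 3) fun f => (key f).2
  refine Subtype.ext (LocFinMeasure.ext_bounded fun s hs hb => ?_)
  rw [LocFinMeasure.apply_eq_sum_part μ.1 hs hb fun i =>
    measure_ne_top_of_isBounded (hm i) hb, Fin.sum_univ_four, h02, h13]
  change _ = (0 : ℂ)
  simp [pow_succ]

lemma eq_of_forall_pairing_eq {ω : Weight} {μ ν : WeightedM ω}
    (h : ∀ g : WeightedC0 ω, pairing g μ = pairing g ν) : μ = ν := by
  refine sub_eq_zero.1 (eq_zero_of_forall_pairing_eq_zero fun g => ?_)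
  have : pairing g (μ - ν) = pairing g μ - pairing g ν := map_sub (pairingLinearMap g) μ ν
  rw [this, h g, sub_self]

/-! ### Lebesgue measure on the half-line -/

lemma measurableEmbedding_coe : MeasurableEmbedding ((↑) : ℝ≥0 → ℝ) :=
  MeasurableEmbedding.subtype_coe measurableSet_Ici

lemma lebesgue_apply (s : Set ℝ≥0) : lebesgue s = volume (((↑) : ℝ≥0 → ℝ) '' s) :=
  measurableEmbedding_coe.comap_apply _ _

instance : IsFiniteMeasureOnCompacts lebesgue :=
  ⟨fun K hK => by
    rw [lebesgue_apply]
    exact (hK.image NNReal.continuous_coe).measure_lt_top⟩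

/-- The preimage is $c\cdot s$. This factor $c$ will cancel the $1/t$ in $\psi(t)/t$. -/
lemma lebesgue_preimage_div {c : ℝ≥0} (hc : c ≠ 0) (s : Set ℝ≥0) :
    lebesgue ((fun x => x / c) ⁻¹' s) = c * lebesgue s := by
  have hc' : (c : ℝ) ≠ 0 := by exact_mod_cast hc
  have h : ((↑) : ℝ≥0 → ℝ) '' ((fun x => x / c) ⁻¹' s) =
      (fun x : ℝ => (c : ℝ)⁻¹ * x) ⁻¹' (((↑) : ℝ≥0 → ℝ) '' s) := by
    ext x
    constructor
    · rintro ⟨y, hy, rfl⟩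
      refine ⟨y / c, hy, ?_⟩
      push_cast
      ring
    · rintro ⟨y, hy, hyx⟩
      refine ⟨c * y, ?_, ?_⟩
      · change c * y / c ∈ s
        rwa [mul_div_cancel_left₀ _ hc]
      · push_cast
        rw [hyx]
        field_simp
  rw [lebesgue_apply, h, Real.volume_preimage_mul_left (inv_ne_zero hc'), lebesgue_apply, inv_inv,
    NNReal.abs_eq, ENNReal.ofReal_coe_nnreal]

/-! ### The dilation measures -/

/-- The measure `(ψ(t) / t) dt` on `[0, 1]`. -/
def dilationMeasure (ψ : unitInterval → ℝ≥0) : Measure unitInterval :=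
  volume.withDensity fun t => ((ψ t / unitInterval.toNNReal t : ℝ≥0) : ℝ≥0∞)

/-- The measure `ψ(t) dt` on `[0, 1]`. -/
def weightMeasure (ψ : unitInterval → ℝ≥0) : Measure unitInterval :=
  volume.withDensity fun t => (ψ t : ℝ≥0∞)

lemma measurable_toNNReal : Measurable unitInterval.toNNReal :=
  unitInterval.toNNReal_continuous.measurable

lemma measurable_dilate :
    Measurable fun p : ℝ≥0 × unitInterval => p.1 / unitInterval.toNNReal p.2 :=
  measurable_fst.div (measurable_toNNReal.comp measurable_snd)

lemma ae_toNNReal_ne_zero : ∀ᵐ t : unitInterval, unitInterval.toNNReal t ≠ 0 := by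
  have h : ∀ᵐ t : unitInterval, t ≠ 0 := by
    rw [ae_iff]
    simp
  filter_upwards [h] with t ht h0
  exact ht (Subtype.ext (congrArg NNReal.toReal h0))

lemma ae_dilationMeasure_of_ae {p : unitInterval → Prop} (h : ∀ᵐ t, p t) :
    ∀ᵐ t ∂dilationMeasure ψ, p t :=
  (withDensity_absolutelyContinuous _ _).ae_le h

lemma aemeasurable_dilation_density (hψ : AEMeasurable ψ volume) :
    AEMeasurable (fun t => ((ψ t / unitInterval.toNNReal t : ℝ≥0) : ℝ≥0∞)) volume :=
  (hψ.div measurable_toNNReal.aemeasurable).coe_nnreal_ennreal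

instance : SFinite (dilationMeasure ψ) := by unfold dilationMeasure; infer_instance

instance : SFinite (weightMeasure ψ) := by unfold weightMeasure; infer_instance

lemma lintegral_dilationMeasure_le {ω₁ ω₂ : Weight} (hψ : AEMeasurable ψ volume) {C : ℝ≥0}
    (hC : ∀ s : ℝ≥0, ∫⁻ t : unitInterval, ((ω₂ (s / unitInterval.toNNReal t) *
      (ψ t / unitInterval.toNNReal t) : ℝ≥0) : ℝ≥0∞) ≤ C * ω₁ s) (s : ℝ≥0) :
    ∫⁻ t, ω₂ (s / unitInterval.toNNReal t) ∂dilationMeasure ψ ≤ C * ω₁ s := by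
  rw [dilationMeasure, lintegral_withDensity_eq_lintegral_mul₀ (aemeasurable_dilation_density hψ)]
  · refine (lintegral_congr fun t => ?_).trans_le (hC s)
    rw [Pi.mul_apply, ← ENNReal.coe_mul, mul_comm]
  · exact ((measurable_weight ω₂).comp
      (measurable_const.div measurable_toNNReal)).aemeasurable

/-- At $s=0$ the bound reads $\omega_2(0)\int_0^1\psi(t)/t\,dt\le C\omega_1(0)$, and
$\omega_2(0)>0$. -/
lemma isFiniteMeasure_dilationMeasure {ω₁ ω₂ : Weight} {C : ℝ≥0}
    (hC : ∀ s, ∫⁻ t, ω₂ (s / unitInterval.toNNReal t) ∂dilationMeasure ψ ≤ C * ω₁ s) :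
    IsFiniteMeasure (dilationMeasure ψ) := by
  have h := hC 0
  simp only [zero_div, lintegral_const] at h
  refine ⟨lt_of_not_ge fun h' => ?_⟩
  rw [top_le_iff.1 h', ENNReal.mul_top (by simpa using (ω₂.pos' 0).ne'), top_le_iff] at h
  exact ENNReal.mul_ne_top ENNReal.coe_ne_top ENNReal.coe_ne_top h

/-- This is the change of variables $x=s/t$ on each slice of fixed $t\ne0$: $ds=t\,dx$ turns
$\psi(t)/t$ into $\psi(t)$. The slice $t=0$, where $s/0=0$ by convention, is negligible. -/
lemma map_dilate_prod (hψ : AEMeasurable ψ volume) :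
    (lebesgue.prod (dilationMeasure ψ)).map
      (fun p => (p.1 / unitInterval.toNNReal p.2, p.2)) = lebesgue.prod (weightMeasure ψ) := by
  have hm : Measurable fun p : ℝ≥0 × unitInterval => (p.1 / unitInterval.toNNReal p.2, p.2) :=
    measurable_dilate.prodMk measurable_snd
  ext s hs
  have hF : Measurable fun t => lebesgue ((fun x => (x, t)) ⁻¹' s) :=
    measurable_measure_prodMk_right hs
  rw [Measure.map_apply hm hs, Measure.prod_apply_symm (hm hs), Measure.prod_apply_symm hs,
    dilationMeasure, weightMeasure,
    lintegral_withDensity_eq_lintegral_mul₀ (aemeasurable_dilation_density hψ)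
      (measurable_measure_prodMk_right (hm hs)).aemeasurable,
    lintegral_withDensity_eq_lintegral_mul₀ hψ.coe_nnreal_ennreal hF.aemeasurable]
  refine lintegral_congr_ae ?_
  filter_upwards [ae_toNNReal_ne_zero] with t ht
  have : (fun x => (x, t)) ⁻¹' ((fun p : ℝ≥0 × unitInterval =>
      (p.1 / unitInterval.toNNReal p.2, p.2)) ⁻¹' s) =
      (fun x => x / unitInterval.toNNReal t) ⁻¹' ((fun x => (x, t)) ⁻¹' s) := rfl
  rw [Pi.mul_apply, Pi.mul_apply, this, lebesgue_preimage_div ht, ← mul_assoc, ← ENNReal.coe_mul,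
    div_mul_cancel₀ _ ht]

/-- For $t\neq0$, $s/t=x$ means $t=s/x$, so up to $t=0$ the set lies in the image of
$N\setminus\{0\}$ under $x\mapsto s/x$. That map is differentiable away from $0$ and so preserves
null sets. This is the source of absolute continuity. -/
lemma dilationMeasure_preimage_eq_zero {s : ℝ≥0} (hs : s ≠ 0) {N : Set ℝ≥0}
    (hN : lebesgue N = 0) :
    dilationMeasure ψ {t | s / unitInterval.toNNReal t ∈ N} = 0 := by
  refine (withDensity_absolutelyContinuous _ _ : dilationMeasure ψ ≪ volume) ?_
  rw [← nonpos_iff_eq_zero]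
  have himg : volume ((fun x : ℝ => (s : ℝ) / x) '' (((↑) : ℝ≥0 → ℝ) '' (N \ {0}))) = 0 := by
    refine addHaar_image_eq_zero_of_differentiableOn_of_addHaar_eq_zero volume ?_ ?_
    · rintro x ⟨y, hy, rfl⟩
      have : (y : ℝ) ≠ 0 := by exact_mod_cast hy.2
      exact ((differentiableAt_const (s : ℝ)).div (differentiableAt_fun_id (𝕜 := ℝ))
        this).differentiableWithinAt
    · rw [← lebesgue_apply]
      exact measure_mono_null Set.sdiff_subset hN
  have hz : (volume : Measure unitInterval) {t | ¬ unitInterval.toNNReal t ≠ 0} = 0 :=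
    ae_iff.1 ae_toNNReal_ne_zero
  have hemb : MeasurableEmbedding ((↑) : unitInterval → ℝ) :=
    MeasurableEmbedding.subtype_coe measurableSet_Icc
  have hv : (volume : Measure unitInterval)
      {t | unitInterval.toNNReal t ≠ 0 ∧ s / unitInterval.toNNReal t ∈ N} = 0 := by
    have : (volume : Measure unitInterval) = (volume : Measure ℝ).comap (↑) := rfl
    rw [this, hemb.comap_apply]
    refine measure_mono_null ?_ himg
    rintro _ ⟨t, ⟨ht, htN⟩, rfl⟩
    refine ⟨_, ⟨_, ⟨htN, div_ne_zero hs ht⟩, rfl⟩, ?_⟩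
    have hs' : (s : ℝ) ≠ 0 := by exact_mod_cast hs
    have ht' : (t : ℝ) ≠ 0 := fun h => ht (Subtype.ext h)
    change (s : ℝ) / (s / unitInterval.toNNReal t : ℝ≥0) = t
    push_cast
    rw [unitInterval.coe_toNNReal]
    field_simp
  calc (volume : Measure unitInterval) {t | s / unitInterval.toNNReal t ∈ N}
      ≤ volume ({t | ¬ unitInterval.toNNReal t ≠ 0} ∪
          {t | unitInterval.toNNReal t ≠ 0 ∧ s / unitInterval.toNNReal t ∈ N}) := by
        refine measure_mono fun t ht => ?_
        by_cases h : unitInterval.toNNReal t ≠ 0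
        · exact Or.inr ⟨h, ht⟩
        · exact Or.inl h
    _ ≤ _ := measure_union_le _ _
    _ = 0 := by rw [hz, hv, add_zero]

/-- The image of `m ⊗ (ψ(t) / t) dt` under `(s, t) ↦ s / t`. -/
def dilated (ψ : unitInterval → ℝ≥0) (m : Measure ℝ≥0) : Measure ℝ≥0 :=
  (m.prod (dilationMeasure ψ)).map fun p => p.1 / unitInterval.toNNReal p.2

lemma lintegral_dilated (m : Measure ℝ≥0) {G : ℝ≥0 → ℝ≥0∞} (hG : Measurable G) :
    ∫⁻ x, G x ∂dilated ψ m =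
      ∫⁻ s, ∫⁻ t, G (s / unitInterval.toNNReal t) ∂dilationMeasure ψ ∂m := by
  rw [dilated, lintegral_map hG measurable_dilate,
    lintegral_prod (fun p => G (p.1 / unitInterval.toNNReal p.2))
      (hG.comp measurable_dilate).aemeasurable]

lemma dilated_apply (m : Measure ℝ≥0) {s : Set ℝ≥0} (hs : MeasurableSet s) :
    dilated ψ m s = ∫⁻ x, dilationMeasure ψ {t | x / unitInterval.toNNReal t ∈ s} ∂m := by
  rw [dilated, Measure.map_apply measurable_dilate hs, Measure.prod_apply (measurable_dilate hs)]
  rfl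

lemma lintegral_dilated_le {ω₁ ω₂ : Weight} {C : ℝ≥0}
    (hC : ∀ s, ∫⁻ t, ω₂ (s / unitInterval.toNNReal t) ∂dilationMeasure ψ ≤ C * ω₁ s)
    (m : Measure ℝ≥0) : ∫⁻ x, ω₂ x ∂dilated ψ m ≤ C * ∫⁻ x, ω₁ x ∂m := by
  rw [lintegral_dilated m (measurable_weight ω₂), ← lintegral_const_mul _ (measurable_weight ω₁)]
  exact lintegral_mono hC

lemma dilated_restrict_absolutelyContinuous (m : Measure ℝ≥0) :
    dilated ψ (m.restrict {0}ᶜ) ≪ lebesgue := by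
  refine Measure.AbsolutelyContinuous.mk fun s hs h => ?_
  rw [dilated_apply _ hs]
  refine (setLIntegral_congr_fun (measurableSet_singleton 0).compl
    fun x hx => dilationMeasure_preimage_eq_zero hx h).trans (by simp)

/-- For $s=0$ the quotient $s/t$ is $0$ for every $t$, so the atom of $m$ at $0$ goes to an atom at
$0$, scaled by the total mass of $\psi(t)/t\,dt$. -/
lemma dilated_eq_add (m : Measure ℝ≥0) :
    dilated ψ m = dilated ψ (m.restrict {0}ᶜ) +
      (m {0} * dilationMeasure ψ Set.univ) • Measure.dirac 0 := by
  ext s hs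
  rw [Measure.add_apply, Measure.smul_apply, dilated_apply _ hs, dilated_apply _ hs,
    ← lintegral_add_compl _ (measurableSet_singleton (0 : ℝ≥0)), add_comm]
  congr 1
  rw [lintegral_singleton, Measure.dirac_apply' _ hs]
  by_cases h0 : (0 : ℝ≥0) ∈ s <;> simp [h0, mul_comm]

lemma sigmaFinite_of_lintegral_weight {ω : Weight} {m : Measure ℝ≥0} (hm : ∫⁻ x, ω x ∂m < ∞) :
    SigmaFinite m := by
  have : IsFiniteMeasureOnCompacts m :=
    ⟨fun K hK => (measure_ne_top_of_isBounded hm hK.isBounded).lt_top⟩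
  infer_instance

/-! ### `L¹(ω)` inside `M(ω)` -/

/-- Positivity of $\omega$ makes the two measures mutually absolutely continuous, so classes in
$L^1(\omega)$ can be handled Lebesgue almost everywhere. -/
lemma ae_withDensity_weight (ω : Weight) :
    ae (lebesgue.withDensity fun x => (ω x : ℝ≥0∞)) = ae lebesgue :=
  le_antisymm (withDensity_absolutelyContinuous _ _).ae_le
    (withDensity_absolutelyContinuous' (measurable_weight ω).aemeasurable
      (Eventually.of_forall fun x => by simpa using (ω.pos' x).ne')).ae_le

lemma ae_eq_of_forall_isBounded_setIntegral_eq {f g : ℝ≥0 → ℂ}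
    (hf : ∀ s, Bornology.IsBounded s → IntegrableOn f s lebesgue)
    (hg : ∀ s, Bornology.IsBounded s → IntegrableOn g s lebesgue)
    (h : ∀ s, MeasurableSet s → Bornology.IsBounded s →
      ∫ x in s, f x ∂lebesgue = ∫ x in s, g x ∂lebesgue) : f =ᵐ[lebesgue] g := by
  have hn : ∀ n, f =ᵐ[lebesgue.restrict (annulus n)] g := fun n =>
    Integrable.ae_eq_of_forall_setIntegral_eq f g (hf _ (isBounded_annulus n))
      (hg _ (isBounded_annulus n)) fun s hs _ => by
        rw [Measure.restrict_restrict hs]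
        exact h _ (hs.inter (measurableSet_annulus n))
          ((isBounded_annulus n).subset Set.inter_subset_right)
  have := (ae_restrict_iUnion_iff annulus fun x => f x = g x).2 hn
  rwa [iUnion_annulus, Measure.restrict_univ] at this

lemma ofL1_apply {ω : Weight} (f : WeightedL1 ω) {s : Set ℝ≥0} (hs : MeasurableSet s)
    (hb : Bornology.IsBounded s) : (ofL1 f).1 s = ∫ x in s, f x ∂lebesgue :=
  densityMeasure_apply (fun x => f x) (fun _ h => weightedL1_integrableOn f h) hs hb

lemma diracZero_apply (ω : Weight) {s : Set ℝ≥0} (hs : MeasurableSet s)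
    (hb : Bornology.IsBounded s) :
    (diracZero ω).1 s = s.indicator (fun _ => (1 : ℂ)) 0 :=
  if_pos ⟨hs, hb⟩

lemma weightedL1_ext {ω : Weight} {f g : WeightedL1 ω} (h : f =ᵐ[lebesgue] g) : f = g :=
  Lp.ext (by rwa [EventuallyEq, ae_withDensity_weight])

/-- The inclusion of `L¹(ω)` in `M(ω)` as a linear map. -/
def ofL1LinearMap (ω : Weight) : WeightedL1 ω →ₗ[ℂ] WeightedM ω where
  toFun := ofL1
  map_add' f g := by
    refine Subtype.ext (LocFinMeasure.ext_bounded fun s hs hb => ?_)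
    change _ = (ofL1 f).1 s + (ofL1 g).1 s
    rw [ofL1_apply _ hs hb, ofL1_apply _ hs hb, ofL1_apply _ hs hb,
      ← integral_add (weightedL1_integrableOn f hb) (weightedL1_integrableOn g hb)]
    have h := Lp.coeFn_add f g
    rw [EventuallyEq, ae_withDensity_weight] at h
    exact integral_congr_ae (ae_restrict_of_ae h)
  map_smul' c f := by
    refine Subtype.ext (LocFinMeasure.ext_bounded fun s hs hb => ?_)
    change _ = c * (ofL1 f).1 s
    rw [ofL1_apply _ hs hb, ofL1_apply _ hs hb, ← integral_const_mul]
    have h := Lp.coeFn_smul c f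
    rw [EventuallyEq, ae_withDensity_weight] at h
    exact integral_congr_ae (ae_restrict_of_ae h)

lemma lebesgue_singleton (x : ℝ≥0) : lebesgue {x} = 0 := by
  rw [lebesgue_apply, Set.image_singleton]
  exact Real.volume_singleton

lemma ofL1_add_smul_diracZero_injective {ω : Weight} {f f' : WeightedL1 ω} {c c' : ℂ}
    (h : ofL1 f + c • diracZero ω = ofL1 f' + c' • diracZero ω) : f = f' ∧ c = c' := by
  have hs : ∀ s, MeasurableSet s → Bornology.IsBounded s →
      ∫ x in s, f x ∂lebesgue + c * s.indicator (fun _ => (1 : ℂ)) 0 =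
        ∫ x in s, f' x ∂lebesgue + c' * s.indicator (fun _ => (1 : ℂ)) 0 := by
    intro s hs hb
    rw [← ofL1_apply f hs hb, ← ofL1_apply f' hs hb, ← diracZero_apply ω hs hb]
    exact congrArg (fun μ : WeightedM ω => μ.1 s) h
  have hc : c = c' := by
    -- The singleton $\{0\}$ is Lebesgue null, so evaluating there isolates the coefficient of
    -- $\delta_0$.
    have := hs {0} (measurableSet_singleton 0) Bornology.isBounded_singleton
    simpa [Measure.restrict_eq_zero.2 (lebesgue_singleton 0)] using this
  refine ⟨weightedL1_ext (ae_eq_of_forall_isBounded_setIntegral_eq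
    (fun s => weightedL1_integrableOn f) (fun s => weightedL1_integrableOn f')
    fun s hsm hb => ?_), hc⟩
  have := hs s hsm hb
  rw [hc] at this
  exact add_right_cancel this

/-- The positive and negative parts of the real and imaginary parts of `z`, in the order of their
coefficients `1, I, -1, -I`. -/
def complexPart (i : Fin 4) (z : ℂ) : ℝ≥0 :=
  ![z.re.toNNReal, z.im.toNNReal, (-z.re).toNNReal, (-z.im).toNNReal] i

lemma measurable_complexPart (i : Fin 4) : Measurable (complexPart i) := by
  fin_cases i
  · exact Complex.measurable_re.real_toNNReal
  · exact Complex.measurable_im.real_toNNReal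
  · exact Complex.measurable_re.neg.real_toNNReal
  · exact Complex.measurable_im.neg.real_toNNReal

lemma complexPart_le (i : Fin 4) (z : ℂ) : complexPart i z ≤ ‖z‖₊ := by
  fin_cases i
  · exact Real.toNNReal_le_iff_le_coe.2 ((le_abs_self _).trans (Complex.abs_re_le_norm z))
  · exact Real.toNNReal_le_iff_le_coe.2 ((le_abs_self _).trans (Complex.abs_im_le_norm z))
  · exact Real.toNNReal_le_iff_le_coe.2 ((neg_le_abs _).trans (Complex.abs_re_le_norm z))
  · exact Real.toNNReal_le_iff_le_coe.2 ((neg_le_abs _).trans (Complex.abs_im_le_norm z))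

lemma sum_complexPart (z : ℂ) :
    ∑ i : Fin 4, Complex.I ^ (i : ℕ) * ((complexPart i z : ℝ) : ℂ) = z := by
  rw [Fin.sum_univ_four]
  have hr := max_zero_sub_max_neg_zero_eq_self z.re
  have hi := max_zero_sub_max_neg_zero_eq_self z.im
  apply Complex.ext
  · simp [complexPart, pow_succ]
    linarith
  · simp [complexPart, pow_succ]
    linarith

lemma measurable_weightedL1 {ω : Weight} (f : WeightedL1 ω) : Measurable f :=
  (Lp.stronglyMeasurable f).measurable

lemma measurable_complexPart_weightedL1 {ω : Weight} (f : WeightedL1 ω) (i : Fin 4) :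
    Measurable fun x => complexPart i (f x) :=
  (measurable_complexPart i).comp (measurable_weightedL1 f)

lemma lintegral_complexPart_lt_top {ω : Weight} (f : WeightedL1 ω) (i : Fin 4) :
    ∫⁻ x, ω x ∂lebesgue.withDensity (fun x => (complexPart i (f x) : ℝ≥0∞)) < ∞ := by
  rw [lintegral_withDensity_eq_lintegral_mul _
    (measurable_complexPart_weightedL1 f i).coe_nnreal_ennreal (measurable_weight ω)]
  refine lt_of_le_of_lt (lintegral_mono fun x => ?_) (lintegral_weightedL1 f)
  rw [Pi.mul_apply, enorm_eq_nnnorm]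
  gcongr
  exact complexPart_le i _

lemma ofL1_eq_sum_positiveM {ω : Weight} (f : WeightedL1 ω) :
    ofL1 f = ∑ i : Fin 4, Complex.I ^ (i : ℕ) • positiveM _ (lintegral_complexPart_lt_top f i) := by
  refine Subtype.ext (LocFinMeasure.ext_bounded fun s hs hb => ?_)
  rw [weightedM_sum_apply, ofL1_apply _ hs hb]
  simp only [positiveM_apply _ hs hb]
  have hfi := weightedL1_integrableOn f hb
  have hint : ∀ i, IntegrableOn (fun x => (complexPart i (f x) : ℝ)) s lebesgue := fun i =>
    Integrable.mono hfi (measurable_complexPart_weightedL1 f i).coe_nnreal_real.aestronglyMeasurable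
      (Eventually.of_forall fun x => by
        rw [Real.norm_of_nonneg (NNReal.coe_nonneg _)]
        exact complexPart_le i (f x))
  have hval : ∀ i, (lebesgue.withDensity fun x => (complexPart i (f x) : ℝ≥0∞)).real s =
      ∫ x in s, (complexPart i (f x) : ℝ) ∂lebesgue := by
    intro i
    rw [Measure.real, withDensity_apply _ hs, integral_eq_lintegral_of_nonneg_ae
      (Eventually.of_forall fun x => NNReal.coe_nonneg _) (hint i).aestronglyMeasurable]
    simp
  simp only [hval, ← integral_complex_ofReal]
  simp_rw [← integral_const_mul]
  rw [← integral_finsetSum _ fun i _ => ((hint i).ofReal.const_mul _)]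
  exact integral_congr_ae (Eventually.of_forall fun x => (sum_complexPart (f x)).symm)

/-- Pairing with a positive measure is an ordinary integral, so $f$ is split into four nonnegative
densities and reassembled. -/
lemma pairing_ofL1 {ω : Weight} (g : WeightedC0 ω) (f : WeightedL1 ω) :
    pairing g (ofL1 f) = ∫ x, f x * g.1 x ∂lebesgue := by
  rw [ofL1_eq_sum_positiveM, pairing_sum]
  have hm := measurable_complexPart_weightedL1 f
  have hint : ∀ i, Integrable (fun x => complexPart i (f x) • g.1 x) lebesgue := fun i =>
    (integrable_withDensity_iff_integrable_smul (hm i)).1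
      (integrable_weightedC0 g (lintegral_complexPart_lt_top f i))
  simp only [pairing_positiveM, integral_withDensity_eq_integral_smul (hm _)]
  simp_rw [← integral_const_mul]
  rw [← integral_finsetSum _ fun i _ => (hint i).const_mul _]
  refine integral_congr_ae (Eventually.of_forall fun x => ?_)
  change _ = f x * g.1 x
  conv_rhs => rw [← sum_complexPart (f x), Finset.sum_mul]
  refine Finset.sum_congr rfl fun i _ => ?_
  rw [NNReal.smul_def, Complex.real_smul, mul_assoc]

/-- The function is the Radon–Nikodym density of $n$; its norm in $L^1(\omega)$ is
$\int\omega\,dn\le\int\omega\,dm$. -/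
lemma positiveM_eq_ofL1_add {ω : Weight} {m n : Measure ℝ≥0} (hm : ∫⁻ x, ω x ∂m < ∞)
    (hn : n ≪ lebesgue) {a : ℝ≥0∞} (hmn : m = n + a • Measure.dirac 0) :
    ∃ (f : WeightedL1 ω) (c : ℂ), positiveM m hm = ofL1 f + c • diracZero ω := by
  have hnm : n ≤ m := hmn ▸ Measure.le_add_right le_rfl
  have hnω : ∫⁻ x, ω x ∂n < ∞ := lt_of_le_of_lt (lintegral_mono' hnm le_rfl) hm
  have := sigmaFinite_of_lintegral_weight hnω
  set k := n.rnDeriv lebesgue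
  have hk : Measurable k := Measure.measurable_rnDeriv _ _
  have hkn : lebesgue.withDensity k = n := Measure.withDensity_rnDeriv_eq _ _ hn
  have hkt : ∀ᵐ x ∂lebesgue, k x < ∞ := Measure.rnDeriv_lt_top n lebesgue
  have hf0 : Measurable fun x => ((k x).toReal : ℂ) :=
    Complex.measurable_ofReal.comp hk.ennreal_toReal
  have hint : Integrable (fun x => ((k x).toReal : ℂ))
      (lebesgue.withDensity fun x => (ω x : ℝ≥0∞)) := by
    refine ⟨hf0.aestronglyMeasurable, ?_⟩
    rw [hasFiniteIntegral_iff_enorm,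
      lintegral_withDensity_eq_lintegral_mul _ (measurable_weight ω) hf0.enorm]
    rw [← hkn, lintegral_withDensity_eq_lintegral_mul _ hk (measurable_weight ω)] at hnω
    refine lt_of_le_of_lt (lintegral_mono fun x => ?_) hnω
    rw [Pi.mul_apply, Pi.mul_apply, mul_comm, ← ofReal_norm, Complex.norm_real,
      Real.norm_of_nonneg ENNReal.toReal_nonneg]
    gcongr
    exact ENNReal.ofReal_toReal_le
  refine ⟨hint.toL1 _, (a.toReal : ℂ), Subtype.ext (LocFinMeasure.ext_bounded fun s hs hb => ?_)⟩
  change _ = (ofL1 (hint.toL1 _)).1 s + (a.toReal : ℂ) * (diracZero ω).1 s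
  have hae := hint.coeFn_toL1
  rw [EventuallyEq, ae_withDensity_weight] at hae
  rw [positiveM_apply hm hs hb, ofL1_apply _ hs hb, diracZero_apply ω hs hb,
    integral_congr_ae (ae_restrict_of_ae hae), integral_complex_ofReal,
    integral_toReal hk.aemeasurable (ae_restrict_of_ae hkt), ← withDensity_apply _ hs, hkn]
  have hms := measure_ne_top_of_isBounded hm hb
  simp only [hmn, Measure.real, Measure.add_apply, Measure.smul_apply, smul_eq_mul] at hms ⊢
  rw [ENNReal.toReal_add (ENNReal.add_ne_top.1 hms).1 (ENNReal.add_ne_top.1 hms).2,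
    ENNReal.toReal_mul, Measure.dirac_apply' _ hs]
  by_cases h0 : (0 : ℝ≥0) ∈ s <;> simp [h0]

/-! ### The restricted adjoint on `C₀(1/ω₂)` -/

/-- The function `s ↦ ∫₀¹ g(s/t) ψ(t)/t dt`. -/
def adjointFun (ψ : unitInterval → ℝ≥0) (g : ℝ≥0 → ℂ) (s : ℝ≥0) : ℂ :=
  ∫ t, g (s / unitInterval.toNNReal t) ∂dilationMeasure ψ

lemma aestronglyMeasurable_dilate {g : ℝ≥0 → ℂ} (hg : Continuous g) (s : ℝ≥0) :
    AEStronglyMeasurable (fun t => g (s / unitInterval.toNNReal t)) (dilationMeasure ψ) :=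
  (hg.measurable.comp (measurable_const.div measurable_toNNReal)).aestronglyMeasurable

/-! ### Weighted bound, continuity and decay of $V_\psi g$ -/

section Bounds

variable (hC : ∀ s, ∫⁻ t, ω₂ (s / unitInterval.toNNReal t) ∂dilationMeasure ψ ≤ C * ω₁ s)
include hC

lemma lintegral_enorm_dilate_le {g : ℝ≥0 → ℂ} {K : ℝ≥0} (hK : ∀ x, ‖g x‖ ≤ K * ω₂ x)
    (s : ℝ≥0) :
    ∫⁻ t, ‖g (s / unitInterval.toNNReal t)‖ₑ ∂dilationMeasure ψ ≤ K * (C * ω₁ s) := by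
  have hm : Measurable fun t => (ω₂ (s / unitInterval.toNNReal t) : ℝ≥0∞) :=
    (measurable_weight ω₂).comp (measurable_const.div measurable_toNNReal)
  calc ∫⁻ t, ‖g (s / unitInterval.toNNReal t)‖ₑ ∂dilationMeasure ψ
      ≤ ∫⁻ t, K * ω₂ (s / unitInterval.toNNReal t) ∂dilationMeasure ψ := by
        refine lintegral_mono fun t => ?_
        rw [enorm_eq_nnnorm, ← ENNReal.coe_mul]
        exact ENNReal.coe_le_coe.2 (hK _)
    _ = K * ∫⁻ t, ω₂ (s / unitInterval.toNNReal t) ∂dilationMeasure ψ :=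
        lintegral_const_mul _ hm
    _ ≤ K * (C * ω₁ s) := by gcongr; exact hC s

lemma integrable_dilate {g : ℝ≥0 → ℂ} (hg : Continuous g) {K : ℝ≥0}
    (hK : ∀ x, ‖g x‖ ≤ K * ω₂ x) (s : ℝ≥0) :
    Integrable (fun t => g (s / unitInterval.toNNReal t)) (dilationMeasure ψ) := by
  refine ⟨aestronglyMeasurable_dilate hg s, ?_⟩
  rw [hasFiniteIntegral_iff_enorm]
  exact lt_of_le_of_lt (lintegral_enorm_dilate_le hC hK s)
    (ENNReal.mul_lt_top ENNReal.coe_lt_top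
      (ENNReal.mul_lt_top ENNReal.coe_lt_top ENNReal.coe_lt_top))

lemma norm_adjointFun_le {g : ℝ≥0 → ℂ} {K : ℝ≥0} (hK : ∀ x, ‖g x‖ ≤ K * ω₂ x) (s : ℝ≥0) :
    ‖adjointFun ψ g s‖ ≤ K * (C * ω₁ s) := by
  have h := (enorm_integral_le_lintegral_enorm _).trans (lintegral_enorm_dilate_le hC hK s)
  rw [enorm_eq_nnnorm, ← ENNReal.coe_mul, ← ENNReal.coe_mul] at h
  exact_mod_cast ENNReal.coe_le_coe.1 h

lemma adjointFun_sub {g h : ℝ≥0 → ℂ} (hg : Continuous g) (hh : Continuous h) {K L : ℝ≥0}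
    (hK : ∀ x, ‖g x‖ ≤ K * ω₂ x) (hL : ∀ x, ‖h x‖ ≤ L * ω₂ x) (s : ℝ≥0) :
    adjointFun ψ (fun x => g x - h x) s = adjointFun ψ g s - adjointFun ψ h s :=
  integral_sub (integrable_dilate hC hg hK s) (integrable_dilate hC hh hL s)

/-- Dominated convergence applies with a constant bound because $\psi(t)/t\,dt$ is a finite measure.
-/
lemma continuous_adjointFun_of_hasCompactSupport {g : ℝ≥0 → ℂ} (hg : Continuous g)
    (hgc : HasCompactSupport g) : Continuous (adjointFun ψ g) := by
  have := isFiniteMeasure_dilationMeasure hC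
  obtain ⟨B, hB⟩ := hgc.exists_bound_of_continuous hg
  refine continuous_of_dominated (bound := fun _ => B) (aestronglyMeasurable_dilate hg)
    (fun s => Eventually.of_forall fun t => hB _) (integrable_const B)
    (Eventually.of_forall fun t => ?_)
  exact hg.comp (continuous_id.div_const _)

omit hC in
lemma eventually_adjointFun_eq_zero {g : ℝ≥0 → ℂ} (hgc : HasCompactSupport g) :
    ∀ᶠ s in cocompact ℝ≥0, adjointFun ψ g s = 0 := by
  obtain ⟨R, hR⟩ := hgc.isBounded.subset_closedBall 0
  have hg0 : ∀ x : ℝ≥0, R < x → g x = 0 := fun x hx => image_eq_zero_of_notMem_tsupport fun h => by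
    have := hR h
    rw [Metric.mem_closedBall, NNReal.dist_eq] at this
    simp at this
    linarith
  filter_upwards [(isCompact_closedBall (0 : ℝ≥0) R).compl_mem_cocompact] with s hs
  have hs' : R < s := by
    simpa [NNReal.dist_eq] using hs
  refine (integral_congr_ae ?_).trans (integral_zero _ _)
  filter_upwards [ae_dilationMeasure_of_ae ae_toNNReal_ne_zero] with t ht
  refine hg0 _ (hs'.trans_le ?_)
  -- Since $t\le1$, dilation by $1/t$ only moves $s$ outward: once $s$ exceeds $R$, so does $s/t$.
  have h1 : unitInterval.toNNReal t ≤ 1 := t.2.2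
  exact_mod_cast le_div_self (zero_le) (pos_iff_ne_zero.2 ht) h1

omit hC in
lemma exists_hasCompactSupport_norm_sub_le (g : WeightedC0 ω₂) {ε : ℝ≥0} (hε : 0 < ε) :
    ∃ h : ℝ≥0 → ℂ, Continuous h ∧ HasCompactSupport h ∧ (∀ x, ‖h x‖ ≤ ‖g.1 x‖) ∧
      ∀ x, ‖g.1 x - h x‖ ≤ ε * ω₂ x := by
  have hg : Tendsto (fun x => ‖g.1 x‖ / (ω₂ x : ℝ)) (cocompact ℝ≥0) (𝓝 0) := g.2
  have hev := hg.eventually (gt_mem_nhds (show (0 : ℝ) < ε from hε))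
  obtain ⟨K, hK, hKε⟩ := mem_cocompact.1 hev
  -- The approximant is $\varphi g$ with a cutoff $\varphi=1$ on the compact set outside which
  -- $|g|<\varepsilon\omega_2$.
  obtain ⟨φ, hφ1, -, hφc, hφ⟩ :=
    exists_continuous_one_zero_of_isCompact hK isClosed_empty (Set.disjoint_empty K)
  refine ⟨fun x => (φ x : ℂ) * g.1 x, (Complex.continuous_ofReal.comp φ.continuous).mul
    g.1.continuous, ?_, fun x => ?_, fun x => ?_⟩
  · exact (hφc.comp_left (g := fun r : ℝ => (r : ℂ)) Complex.ofReal_zero).mul_right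
  · rw [norm_mul, Complex.norm_real, Real.norm_of_nonneg (hφ x).1]
    exact mul_le_of_le_one_left (norm_nonneg _) (hφ x).2
  · have hx : (0 : ℝ) < ω₂ x := ω₂.pos' x
    by_cases hxK : x ∈ K
    · have h1 : φ x = 1 := hφ1 hxK
      simp [h1]
      positivity
    · have hgx := (div_lt_iff₀ hx).1 (hKε hxK)
      have h1 : g.1 x - (φ x : ℂ) * g.1 x = ((1 - φ x : ℝ) : ℂ) * g.1 x := by
        push_cast
        ring
      rw [h1, norm_mul, Complex.norm_real, Real.norm_of_nonneg (sub_nonneg.2 (hφ x).2)]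
      refine (mul_le_of_le_one_left (norm_nonneg _) ?_).trans hgx.le
      linarith [(hφ x).1]

lemma exists_adjointFun_approx (g : WeightedC0 ω₂) {ε : ℝ≥0} (hε : 0 < ε) :
    ∃ k : ℝ≥0 → ℂ, Continuous k ∧ (∀ᶠ s in cocompact ℝ≥0, k s = 0) ∧
      ∀ s, ‖adjointFun ψ g.1 s - k s‖ ≤ ε * (C * ω₁ s) := by
  obtain ⟨h, hc, hs, hle, hε'⟩ := exists_hasCompactSupport_norm_sub_le g hε
  obtain ⟨K, hK⟩ := exists_norm_le_mul_weight g
  refine ⟨adjointFun ψ h, continuous_adjointFun_of_hasCompactSupport hC hc hs,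
    eventually_adjointFun_eq_zero hs, fun s => ?_⟩
  rw [← adjointFun_sub hC g.1.continuous hc hK (fun x => (hle x).trans (hK x)) s]
  exact norm_adjointFun_le hC hε' s

lemma exists_quotient_approx (g : WeightedC0 ω₂) {ε : ℝ} (hε : 0 < ε) :
    ∃ k : ℝ≥0 → ℂ, Continuous k ∧ (∀ᶠ s in cocompact ℝ≥0, k s = 0) ∧
      ∀ s, ‖adjointFun ψ g.1 s / (ω₁ s : ℝ) - k s‖ < ε := by
  -- Dividing by $C+1$ rather than $C$ covers $C=0$ and keeps the final inequality strict.
  have hpos : 0 < ε / (C + 1) := by positivity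
  obtain ⟨k, hk, hk0, hkε⟩ := exists_adjointFun_approx hC g (ε := ⟨ε / (C + 1), hpos.le⟩) hpos
  have hω : ∀ s, ((ω₁ s : ℝ) : ℂ) ≠ 0 := fun s => by
    exact_mod_cast (ω₁.pos' s).ne'
  refine ⟨fun s => k s / (ω₁ s : ℝ), hk.div (Complex.continuous_ofReal.comp
    (NNReal.continuous_coe.comp ω₁.continuous')) hω, hk0.mono fun s hs => by simp [hs],
    fun s => ?_⟩
  have hs : (0 : ℝ) < ω₁ s := ω₁.pos' s
  rw [← sub_div, norm_div, Complex.norm_real, Real.norm_of_nonneg hs.le, div_lt_iff₀ hs]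
  refine (hkε s).trans_lt ?_
  change ε / (C + 1) * (C * ω₁ s) < ε * ω₁ s
  rw [← mul_assoc]
  refine mul_lt_mul_of_pos_right ?_ hs
  rw [div_mul_eq_mul_div, div_lt_iff₀ (by positivity)]
  nlinarith

lemma continuous_adjointFun (g : WeightedC0 ω₂) : Continuous (adjointFun ψ g.1) := by
  have hω : Continuous fun s => ((ω₁ s : ℝ) : ℂ) :=
    Complex.continuous_ofReal.comp (NNReal.continuous_coe.comp ω₁.continuous')
  have h : Continuous fun s => adjointFun ψ g.1 s / (ω₁ s : ℝ) := by
    refine continuous_of_uniform_approx_of_continuous fun u hu => ?_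
    obtain ⟨ε, hε, hεu⟩ := Metric.mem_uniformity_dist.1 hu
    obtain ⟨k, hk, -, hkε⟩ := exists_quotient_approx hC g hε
    exact ⟨k, hk, fun s => hεu (by rw [dist_eq_norm]; exact hkε s)⟩
  refine (h.mul hω).congr fun s => div_mul_cancel₀ _ ?_
  exact_mod_cast (ω₁.pos' s).ne'

lemma tendsto_adjointFun (g : WeightedC0 ω₂) :
    Tendsto (fun s => ‖adjointFun ψ g.1 s‖ / (ω₁ s : ℝ)) (cocompact ℝ≥0) (𝓝 0) := by
  refine Metric.tendsto_nhds.2 fun ε hε => ?_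
  obtain ⟨k, -, hk0, hkε⟩ := exists_quotient_approx hC g hε
  filter_upwards [hk0] with s hs
  have := hkε s
  rw [hs, sub_zero, norm_div, Complex.norm_real, Real.norm_of_nonneg (NNReal.coe_nonneg _)] at this
  rwa [dist_zero_right, Real.norm_of_nonneg (by positivity)]

end Bounds

/-- The operator `V_ψ : C₀(1/ω₂) → C₀(1/ω₁)`. -/
def restrictedAdjoint
    (hC : ∀ s, ∫⁻ t, ω₂ (s / unitInterval.toNNReal t) ∂dilationMeasure ψ ≤ C * ω₁ s) :
    WeightedC0 ω₂ →ₗ[ℂ] WeightedC0 ω₁ where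
  toFun g := ⟨⟨adjointFun ψ g.1, continuous_adjointFun hC g⟩, tendsto_adjointFun hC g⟩
  map_add' g h := by
    obtain ⟨K, hK⟩ := exists_norm_le_mul_weight g
    obtain ⟨L, hL⟩ := exists_norm_le_mul_weight h
    refine Subtype.ext (ContinuousMap.ext fun s => ?_)
    exact integral_add (integrable_dilate hC g.1.continuous hK s)
      (integrable_dilate hC h.1.continuous hL s)
  map_smul' c g := by
    refine Subtype.ext (ContinuousMap.ext fun s => ?_)
    exact integral_const_mul c _

lemma restrictedAdjoint_apply
    (hC : ∀ s, ∫⁻ t, ω₂ (s / unitInterval.toNNReal t) ∂dilationMeasure ψ ≤ C * ω₁ s)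
    (g : WeightedC0 ω₂) (s : ℝ≥0) :
    (restrictedAdjoint hC g).1 s = ∫ t, g.1 (s / unitInterval.toNNReal t) ∂dilationMeasure ψ :=
  rfl

/-! ### The generalized Hardy-Cesàro operator -/

lemma measurable_scale :
    Measurable fun p : ℝ≥0 × unitInterval => unitInterval.toNNReal p.2 * p.1 :=
  (measurable_toNNReal.comp measurable_snd).mul measurable_fst

lemma measurePreserving_dilate (hψ : AEMeasurable ψ volume) :
    MeasurePreserving (fun p : ℝ≥0 × unitInterval => (p.1 / unitInterval.toNNReal p.2, p.2))
      (lebesgue.prod (dilationMeasure ψ)) (lebesgue.prod (weightMeasure ψ)) :=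
  ⟨measurable_dilate.prodMk measurable_snd, map_dilate_prod hψ⟩

lemma ae_scale_dilate_eq :
    ∀ᵐ p ∂lebesgue.prod (dilationMeasure ψ),
      unitInterval.toNNReal p.2 * (p.1 / unitInterval.toNNReal p.2) = p.1 := by
  have h : ∀ᵐ t ∂dilationMeasure ψ, unitInterval.toNNReal t ≠ 0 :=
    ae_dilationMeasure_of_ae ae_toNNReal_ne_zero
  filter_upwards [Measure.quasiMeasurePreserving_snd.ae h] with p hp
  exact mul_div_cancel₀ _ hp

/-- After the change of variables $x=s/t$ the map $(x,t)\mapsto tx$ becomes the projection to $s$.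
Consequently $U_\psi f$ depends only on the class of $f$. -/
lemma quasiMeasurePreserving_scale (hψ : AEMeasurable ψ volume) :
    Measure.QuasiMeasurePreserving
      (fun p : ℝ≥0 × unitInterval => unitInterval.toNNReal p.2 * p.1)
      (lebesgue.prod (weightMeasure ψ)) lebesgue := by
  refine ⟨measurable_scale, ?_⟩
  rw [← (measurePreserving_dilate hψ).map_eq, Measure.map_map measurable_scale
    (measurePreserving_dilate hψ).measurable]
  have : (fun p : ℝ≥0 × unitInterval => unitInterval.toNNReal p.2 * p.1) ∘
      (fun p : ℝ≥0 × unitInterval => (p.1 / unitInterval.toNNReal p.2, p.2))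
      =ᵐ[lebesgue.prod (dilationMeasure ψ)] Prod.fst := ae_scale_dilate_eq
  rw [Measure.map_congr this]
  exact Measure.quasiMeasurePreserving_fst.absolutelyContinuous

/-- The function `x ↦ ∫₀¹ f(tx) ψ(t) dt`. -/
def hardyFun (ψ : unitInterval → ℝ≥0) (f : ℝ≥0 → ℂ) (x : ℝ≥0) : ℂ :=
  ∫ t, f (unitInterval.toNNReal t * x) ∂weightMeasure ψ

lemma stronglyMeasurable_hardyFun {f : ℝ≥0 → ℂ} (hf : Measurable f) :
    StronglyMeasurable (hardyFun ψ f) :=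
  StronglyMeasurable.integral_prod_right
    (f := fun x t => f (unitInterval.toNNReal t * x)) (hf.comp measurable_scale).stronglyMeasurable

lemma ae_ae_scale_eq (hψ : AEMeasurable ψ volume) {f g : ℝ≥0 → ℂ} (h : f =ᵐ[lebesgue] g) :
    ∀ᵐ x ∂lebesgue, ∀ᵐ t ∂weightMeasure ψ,
      f (unitInterval.toNNReal t * x) = g (unitInterval.toNNReal t * x) :=
  Measure.ae_ae_of_ae_prod ((quasiMeasurePreserving_scale hψ).ae h)

lemma hardyFun_congr_ae (hψ : AEMeasurable ψ volume) {f g : ℝ≥0 → ℂ} (h : f =ᵐ[lebesgue] g) :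
    hardyFun ψ f =ᵐ[lebesgue] hardyFun ψ g := by
  filter_upwards [ae_ae_scale_eq hψ h] with x hx
  exact integral_congr_ae hx

lemma integrable_weightMeasure_iff (hψ : AEMeasurable ψ volume) (F : unitInterval → ℂ) :
    Integrable F (weightMeasure ψ) ↔ Integrable (fun t => F t * ((ψ t : ℝ) : ℂ)) := by
  rw [weightMeasure, integrable_withDensity_iff_integrable_smul₀ hψ]
  refine integrable_congr (Eventually.of_forall fun t => ?_)
  simp only [NNReal.smul_def, Complex.real_smul, mul_comm]

lemma integral_weightMeasure (hψ : AEMeasurable ψ volume) (F : unitInterval → ℂ) :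
    ∫ t, F t ∂weightMeasure ψ = ∫ t, F t * ((ψ t : ℝ) : ℂ) := by
  rw [weightMeasure, integral_withDensity_eq_integral_smul₀ hψ]
  refine integral_congr_ae (Eventually.of_forall fun t => ?_)
  simp only [NNReal.smul_def, Complex.real_smul, mul_comm]

/-! ### Weighted $L^1$ estimates, the operator $U_\psi$ and its adjoint relation -/

section Bounds

variable (hψ : AEMeasurable ψ volume)
  (hC : ∀ s, ∫⁻ t, ω₂ (s / unitInterval.toNNReal t) ∂dilationMeasure ψ ≤ C * ω₁ s)

include hψ hC

/-- Changing variables turns the left side into $\int|f(s)|\int\omega_2(s/t)\,\psi(t)/t\,dt\,ds$, to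
which (C) applies for each $s$. The same finiteness later licenses Fubini. -/
lemma lintegral_scale_le {f : ℝ≥0 → ℂ} (hf : Measurable f) :
    ∫⁻ p, ‖f (unitInterval.toNNReal p.2 * p.1)‖ₑ * ω₂ p.1 ∂lebesgue.prod (weightMeasure ψ) ≤
      C * ∫⁻ s, ‖f s‖ₑ * ω₁ s ∂lebesgue := by
  have hm : Measurable fun p : ℝ≥0 × unitInterval =>
      ‖f (unitInterval.toNNReal p.2 * p.1)‖ₑ * ω₂ p.1 :=
    (hf.comp measurable_scale).enorm.mul ((measurable_weight ω₂).comp measurable_fst)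
  have hm' : Measurable fun p : ℝ≥0 × unitInterval =>
      ‖f p.1‖ₑ * ω₂ (p.1 / unitInterval.toNNReal p.2) :=
    (hf.comp measurable_fst).enorm.mul ((measurable_weight ω₂).comp measurable_dilate)
  rw [← (measurePreserving_dilate hψ).lintegral_comp hm]
  calc ∫⁻ p, ‖f (unitInterval.toNNReal p.2 * (p.1 / unitInterval.toNNReal p.2))‖ₑ *
          ω₂ (p.1 / unitInterval.toNNReal p.2) ∂lebesgue.prod (dilationMeasure ψ)
      = ∫⁻ p, ‖f p.1‖ₑ * ω₂ (p.1 / unitInterval.toNNReal p.2)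
          ∂lebesgue.prod (dilationMeasure ψ) := by
        refine lintegral_congr_ae ?_
        filter_upwards [ae_scale_dilate_eq] with p hp
        rw [hp]
    _ = ∫⁻ s, ∫⁻ t, ‖f s‖ₑ * ω₂ (s / unitInterval.toNNReal t) ∂dilationMeasure ψ ∂lebesgue :=
        lintegral_prod _ hm'.aemeasurable
    _ ≤ ∫⁻ s, C * (‖f s‖ₑ * ω₁ s) ∂lebesgue := by
        refine lintegral_mono fun s => ?_
        rw [lintegral_const_mul' _ _ enorm_ne_top]
        calc ‖f s‖ₑ * _ ≤ ‖f s‖ₑ * (C * ω₁ s) := by gcongr; exact hC s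
          _ = _ := by ring
    _ = C * ∫⁻ s, ‖f s‖ₑ * ω₁ s ∂lebesgue :=
        lintegral_const_mul _ (hf.enorm.mul (measurable_weight ω₁))

lemma lintegral_hardyFun_le {f : ℝ≥0 → ℂ} (hf : Measurable f) :
    ∫⁻ x, ‖hardyFun ψ f x‖ₑ * ω₂ x ∂lebesgue ≤ C * ∫⁻ s, ‖f s‖ₑ * ω₁ s ∂lebesgue := by
  refine le_trans ?_ (lintegral_scale_le hψ hC hf)
  have hm : Measurable fun p : ℝ≥0 × unitInterval =>
      ‖f (unitInterval.toNNReal p.2 * p.1)‖ₑ * ω₂ p.1 :=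
    (hf.comp measurable_scale).enorm.mul ((measurable_weight ω₂).comp measurable_fst)
  rw [lintegral_prod _ hm.aemeasurable]
  refine lintegral_mono fun x => ?_
  change _ ≤ ∫⁻ t, ‖f (unitInterval.toNNReal t * x)‖ₑ * ω₂ x ∂weightMeasure ψ
  rw [lintegral_mul_const' _ _ ENNReal.coe_ne_top]
  gcongr
  exact enorm_integral_le_lintegral_enorm _

lemma ae_integrable_scale (f : WeightedL1 ω₁) :
    ∀ᵐ x ∂lebesgue, Integrable (fun t => f (unitInterval.toNNReal t * x)) (weightMeasure ψ) := by
  have hf := measurable_weightedL1 f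
  have hm : Measurable fun p : ℝ≥0 × unitInterval =>
      ‖f (unitInterval.toNNReal p.2 * p.1)‖ₑ * ω₂ p.1 :=
    (hf.comp measurable_scale).enorm.mul ((measurable_weight ω₂).comp measurable_fst)
  have h := (lintegral_scale_le hψ hC hf).trans_lt
    (ENNReal.mul_lt_top ENNReal.coe_lt_top (lintegral_weightedL1 f))
  rw [lintegral_prod _ hm.aemeasurable] at h
  filter_upwards [ae_lt_top hm.lintegral_prod_right' h.ne] with x hx
  refine ⟨(hf.comp (measurable_toNNReal.mul_const x)).aestronglyMeasurable, ?_⟩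
  rw [hasFiniteIntegral_iff_enorm]
  simp only [lintegral_mul_const' _ _ ENNReal.coe_ne_top] at hx
  rcases ENNReal.mul_lt_top_iff.1 hx with h | h | h
  · exact h.1
  · rw [h]; exact ENNReal.zero_lt_top
  · exact absurd h (by simpa using (ω₂.pos' x).ne')

lemma integrable_hardyFun (f : WeightedL1 ω₁) :
    Integrable (hardyFun ψ f) (lebesgue.withDensity fun x => (ω₂ x : ℝ≥0∞)) := by
  have hm := stronglyMeasurable_hardyFun (ψ := ψ) (measurable_weightedL1 f)
  refine ⟨hm.aestronglyMeasurable, ?_⟩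
  rw [hasFiniteIntegral_iff_enorm,
    lintegral_withDensity_eq_lintegral_mul _ (measurable_weight ω₂) hm.measurable.enorm]
  simp only [Pi.mul_apply, mul_comm _ ‖_‖ₑ]
  exact (lintegral_hardyFun_le hψ hC (measurable_weightedL1 f)).trans_lt
    (ENNReal.mul_lt_top ENNReal.coe_lt_top (lintegral_weightedL1 f))

lemma coeFn_toL1_hardyFun (f : WeightedL1 ω₁) :
    (integrable_hardyFun hψ hC f).toL1 _ =ᵐ[lebesgue] hardyFun ψ f := by
  have h := (integrable_hardyFun hψ hC f).coeFn_toL1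
  rwa [EventuallyEq, ae_withDensity_weight] at h

omit hψ hC in
lemma norm_weightedL1 {ω : Weight} (f : WeightedL1 ω) :
    ‖f‖ = (∫⁻ x, ‖f x‖ₑ * ω x ∂lebesgue).toReal := by
  rw [Lp.norm_def, eLpNorm_one_eq_lintegral_enorm,
    lintegral_withDensity_eq_lintegral_mul _ (measurable_weight ω)
      (measurable_weightedL1 f).enorm]
  simp only [Pi.mul_apply, mul_comm]

/-- The operator `U_ψ : L¹(ω₁) → L¹(ω₂)`. -/
def hardyCesaro : WeightedL1 ω₁ →L[ℂ] WeightedL1 ω₂ :=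
  LinearMap.mkContinuous
    { toFun := fun f => (integrable_hardyFun hψ hC f).toL1 _
      map_add' := fun f g => by
        refine weightedL1_ext ?_
        have hadd := Lp.coeFn_add ((integrable_hardyFun hψ hC f).toL1 _)
          ((integrable_hardyFun hψ hC g).toL1 _)
        have hfg := Lp.coeFn_add f g
        rw [EventuallyEq, ae_withDensity_weight] at hadd hfg
        filter_upwards [hadd, hardyFun_congr_ae hψ hfg, coeFn_toL1_hardyFun hψ hC (f + g),
          coeFn_toL1_hardyFun hψ hC f, coeFn_toL1_hardyFun hψ hC g,
          ae_integrable_scale hψ hC f, ae_integrable_scale hψ hC g] with x h1 h2 h3 h4 h5 h6 h7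
        rw [h1, h3, h2, Pi.add_apply, h4, h5]
        exact integral_add h6 h7
      map_smul' := fun c f => by
        refine weightedL1_ext ?_
        have hsmul := Lp.coeFn_smul c ((integrable_hardyFun hψ hC f).toL1 _)
        have hcf := Lp.coeFn_smul c f
        rw [EventuallyEq, ae_withDensity_weight] at hsmul hcf
        filter_upwards [hsmul, hardyFun_congr_ae hψ hcf, coeFn_toL1_hardyFun hψ hC (c • f),
          coeFn_toL1_hardyFun hψ hC f] with x h1 h2 h3 h4
        rw [RingHom.id_apply, h1, h3, h2, Pi.smul_apply, h4]
        exact integral_smul c _ } C fun f => by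
    change ‖(integrable_hardyFun hψ hC f).toL1 _‖ ≤ C * ‖f‖
    rw [norm_weightedL1, norm_weightedL1, ← ENNReal.coe_toReal C, ← ENNReal.toReal_mul]
    refine ENNReal.toReal_mono
      (ENNReal.mul_lt_top ENNReal.coe_lt_top (lintegral_weightedL1 f)).ne ?_
    refine (lintegral_congr_ae ?_).trans_le (lintegral_hardyFun_le hψ hC (measurable_weightedL1 f))
    filter_upwards [coeFn_toL1_hardyFun hψ hC f] with x hx
    rw [hx]

lemma isHardyCesaro_hardyCesaro : IsHardyCesaro ψ (hardyCesaro hψ hC) := by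
  intro f
  filter_upwards [ae_integrable_scale hψ hC f, coeFn_toL1_hardyFun hψ hC f] with x h1 h2
  exact ⟨(integrable_weightMeasure_iff hψ _).1 h1, h2.trans (integral_weightMeasure hψ _)⟩

omit hC in
lemma IsHardyCesaro.ae_eq {U : WeightedL1 ω₁ →L[ℂ] WeightedL1 ω₂} (hU : IsHardyCesaro ψ U)
    (f : WeightedL1 ω₁) : U f =ᵐ[lebesgue] hardyFun ψ f := by
  filter_upwards [hU f] with x hx
  exact hx.2.trans (integral_weightMeasure hψ _).symm

/-- Fubini on both sides of the change of variables $x=s/t$; integrability follows from $|g|\le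
K\omega_2$ and `lintegral_scale_le`. -/
lemma IsHardyCesaro.isRestrictedAdjoint {U : WeightedL1 ω₁ →L[ℂ] WeightedL1 ω₂}
    (hU : IsHardyCesaro ψ U) : IsRestrictedAdjoint U (restrictedAdjoint hC) := by
  intro f g
  have hf := measurable_weightedL1 f
  obtain ⟨K, hK⟩ := exists_norm_le_mul_weight g
  have hmeas : Measurable fun p : ℝ≥0 × unitInterval =>
      f (unitInterval.toNNReal p.2 * p.1) * g.1 p.1 :=
    (hf.comp measurable_scale).mul (g.1.continuous.measurable.comp measurable_fst)
  have hint : Integrable (fun p : ℝ≥0 × unitInterval =>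
      f (unitInterval.toNNReal p.2 * p.1) * g.1 p.1) (lebesgue.prod (weightMeasure ψ)) := by
    refine ⟨hmeas.aestronglyMeasurable, ?_⟩
    rw [hasFiniteIntegral_iff_enorm]
    calc ∫⁻ p, ‖f (unitInterval.toNNReal p.2 * p.1) * g.1 p.1‖ₑ ∂lebesgue.prod (weightMeasure ψ)
        ≤ ∫⁻ p, K * (‖f (unitInterval.toNNReal p.2 * p.1)‖ₑ * ω₂ p.1)
            ∂lebesgue.prod (weightMeasure ψ) := by
          refine lintegral_mono fun p => ?_
          rw [enorm_mul, mul_left_comm]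
          gcongr
          rw [enorm_eq_nnnorm, ← ENNReal.coe_mul]
          exact ENNReal.coe_le_coe.2 (hK _)
      _ = K * ∫⁻ p, ‖f (unitInterval.toNNReal p.2 * p.1)‖ₑ * ω₂ p.1
            ∂lebesgue.prod (weightMeasure ψ) :=
          lintegral_const_mul' _ _ ENNReal.coe_ne_top
      _ < ∞ := ENNReal.mul_lt_top ENNReal.coe_lt_top ((lintegral_scale_le hψ hC hf).trans_lt
          (ENNReal.mul_lt_top ENNReal.coe_lt_top (lintegral_weightedL1 f)))
  have hae : (fun p : ℝ≥0 × unitInterval =>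
      f (unitInterval.toNNReal p.2 * (p.1 / unitInterval.toNNReal p.2)) *
        g.1 (p.1 / unitInterval.toNNReal p.2)) =ᵐ[lebesgue.prod (dilationMeasure ψ)]
      fun p => f p.1 * g.1 (p.1 / unitInterval.toNNReal p.2) := by
    filter_upwards [ae_scale_dilate_eq] with p hp
    rw [hp]
  have hint' := ((measurePreserving_dilate hψ).integrable_comp_of_integrable hint).congr hae
  calc ∫ x, U f x * g.1 x ∂lebesgue
      = ∫ x, ∫ t, f (unitInterval.toNNReal t * x) * g.1 x ∂weightMeasure ψ ∂lebesgue := by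
        refine integral_congr_ae ?_
        filter_upwards [hU.ae_eq hψ f] with x hx
        rw [hx, hardyFun, integral_mul_const]
    _ = ∫ p, f (unitInterval.toNNReal p.2 * p.1) * g.1 p.1 ∂lebesgue.prod (weightMeasure ψ) :=
        (integral_prod _ hint).symm
    _ = ∫ p, f p.1 * g.1 (p.1 / unitInterval.toNNReal p.2) ∂lebesgue.prod (dilationMeasure ψ) := by
        rw [← (measurePreserving_dilate hψ).map_eq,
          integral_map (measurePreserving_dilate hψ).measurable.aemeasurable
            hmeas.aestronglyMeasurable]
        exact integral_congr_ae hae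
    _ = ∫ s, ∫ t, f s * g.1 (s / unitInterval.toNNReal t) ∂dilationMeasure ψ ∂lebesgue :=
        integral_prod _ hint'
    _ = ∫ s, f s * (restrictedAdjoint hC g).1 s ∂lebesgue := by
        simp only [integral_const_mul, restrictedAdjoint_apply]

end Bounds

/-! ### Uniqueness of the restricted adjoint -/

/-- A relatively open set may contain the endpoint $0$, but it always meets $(0,\infty)$ in a
nonempty open subset of the line. -/
instance : Measure.IsOpenPosMeasure lebesgue := by
  refine ⟨fun U hU hne h0 => ?_⟩
  obtain ⟨O, hO, rfl⟩ := isOpen_induced_iff.1 hU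
  obtain ⟨y, hy⟩ := hne
  have hcl : (y : ℝ) ∈ closure (Set.Ioi (0 : ℝ)) := by
    rw [closure_Ioi]
    exact y.2
  have hpos := (hO.inter isOpen_Ioi).measure_pos (volume : Measure ℝ)
    (mem_closure_iff.1 hcl O hO hy)
  refine hpos.ne' (measure_mono_null ?_ ((lebesgue_apply _).symm.trans h0))
  rintro x ⟨hxO, hx⟩
  exact ⟨⟨x, le_of_lt hx⟩, hxO, rfl⟩

lemma integrableOn_weightedC0 {ω : Weight} (g : WeightedC0 ω) (s : Set ℝ≥0)
    (hb : Bornology.IsBounded s) : IntegrableOn g.1 s lebesgue :=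
  (g.1.continuous.continuousOn.integrableOn_compact hb.isCompact_closure).mono_set subset_closure

/-- Indicators of bounded Borel sets lie in $L^1(\omega)$, so they force almost everywhere equality,
which continuity upgrades to equality. -/
lemma weightedC0_ext_of_integral {ω : Weight} {g h : WeightedC0 ω}
    (H : ∀ f : WeightedL1 ω, ∫ x, f x * g.1 x ∂lebesgue = ∫ x, f x * h.1 x ∂lebesgue) : g = h := by
  refine Subtype.ext (ContinuousMap.ext (congrFun ?_))
  refine (Continuous.ae_eq_iff_eq lebesgue g.1.continuous h.1.continuous).1
    (ae_eq_of_forall_isBounded_setIntegral_eq (integrableOn_weightedC0 g)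
      (integrableOn_weightedC0 h) fun s hs hb => ?_)
  have hfin : (lebesgue.withDensity fun x => (ω x : ℝ≥0∞)) s ≠ ∞ := by
    rw [withDensity_apply _ hs]
    refine (lt_of_le_of_lt (lintegral_mono_set subset_closure) ?_).ne
    have hi : IntegrableOn (fun x => (ω x : ℝ)) (closure s) lebesgue :=
      (NNReal.continuous_coe.comp ω.continuous').continuousOn.integrableOn_compact
        hb.isCompact_closure
    have := hi.hasFiniteIntegral
    rw [hasFiniteIntegral_iff_enorm] at this
    simpa [enorm_eq_nnnorm] using this
  have e : ∀ k : ℝ≥0 → ℂ, ∫ x, indicatorConstLp 1 hs hfin (1 : ℂ) x * k x ∂lebesgue =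
      ∫ x in s, k x ∂lebesgue := by
    intro k
    rw [← integral_indicator hs]
    have hind := indicatorConstLp_coeFn (p := 1) (hs := hs) (hμs := hfin) (c := (1 : ℂ))
    rw [EventuallyEq, ae_withDensity_weight] at hind
    refine integral_congr_ae ?_
    filter_upwards [hind] with x hx
    rw [hx]
    by_cases hxs : x ∈ s <;> simp [hxs]
  rw [← e, ← e]
  exact H _

lemma IsRestrictedAdjoint.unique (hψ : AEMeasurable ψ volume)
    {U U' : WeightedL1 ω₁ →L[ℂ] WeightedL1 ω₂} {V V' : WeightedC0 ω₂ →ₗ[ℂ] WeightedC0 ω₁}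
    (hU : IsHardyCesaro ψ U) (hU' : IsHardyCesaro ψ U')
    (hV : IsRestrictedAdjoint U V) (hV' : IsRestrictedAdjoint U' V') : V = V' := by
  refine LinearMap.ext fun g => weightedC0_ext_of_integral fun f => ?_
  rw [← hV f g, ← hV' f g]
  refine integral_congr_ae ?_
  filter_upwards [hU.ae_eq hψ f, hU'.ae_eq hψ f] with x h1 h2
  rw [h1, h2]

/-! ### The extension to measures -/

section Extension

variable (hC : ∀ s, ∫⁻ t, ω₂ (s / unitInterval.toNNReal t) ∂dilationMeasure ψ ≤ C * ω₁ s)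

include hC in
lemma lintegral_dilated_lt_top {m : Measure ℝ≥0} (hm : ∫⁻ x, ω₁ x ∂m < ∞) :
    ∫⁻ x, ω₂ x ∂dilated ψ m < ∞ :=
  (lintegral_dilated_le hC m).trans_lt (ENNReal.mul_lt_top ENNReal.coe_lt_top hm)

lemma integral_dilated {m : Measure ℝ≥0} (hm : ∫⁻ x, ω₁ x ∂m < ∞) (g : WeightedC0 ω₂) :
    ∫ x, g.1 x ∂dilated ψ m = ∫ s, (restrictedAdjoint hC g).1 s ∂m := by
  have := sigmaFinite_of_lintegral_weight hm
  have hint := (integrable_weightedC0 g (lintegral_dilated_lt_top hC hm)).comp_measurable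
    measurable_dilate
  rw [dilated, integral_map measurable_dilate.aemeasurable
    g.1.continuous.aestronglyMeasurable]
  exact integral_prod _ hint

/-- The measure `∑ i, I ^ i • (dilated ψ mᵢ)`, where the `mᵢ` are the parts of `μ`. -/
def extensionFun (μ : WeightedM ω₁) : WeightedM ω₂ :=
  ∑ i : Fin 4, Complex.I ^ (i : ℕ) •
    positiveM _ (lintegral_dilated_lt_top hC (lintegral_part_lt_top μ i))

lemma pairing_extensionFun (g : WeightedC0 ω₂) (μ : WeightedM ω₁) :
    pairing g (extensionFun hC μ) = pairing (restrictedAdjoint hC g) μ := by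
  conv_rhs => rw [eq_sum_positiveM μ]
  rw [extensionFun, pairing_sum, pairing_sum]
  simp only [pairing_positiveM]
  exact Finset.sum_congr rfl fun i _ => by rw [integral_dilated hC (lintegral_part_lt_top μ i)]

/-- The operator `Ū_ψ : M(ω₁) → M(ω₂)`. -/
def extension : WeightedM ω₁ →ₗ[ℂ] WeightedM ω₂ where
  toFun := extensionFun hC
  -- The Jordan decomposition is not additive, so linearity is not visible from the formula. It
  -- follows from the duality identity, since $C_0(1/\omega_2)$ separates measures.
  map_add' μ ν := eq_of_forall_pairing_eq fun g => by
    rw [pairing_extensionFun]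
    change pairingLinearMap _ (μ + ν) = pairingLinearMap g (_ + _)
    rw [map_add, map_add]
    exact congrArg₂ _ (pairing_extensionFun hC g μ).symm (pairing_extensionFun hC g ν).symm
  map_smul' c μ := eq_of_forall_pairing_eq fun g => by
    rw [pairing_extensionFun]
    change pairingLinearMap _ (c • μ) = pairingLinearMap g (c • _)
    rw [map_smul, map_smul]
    exact congrArg _ (pairing_extensionFun hC g μ).symm

lemma weightedNorm_extension_le (μ : WeightedM ω₁) :
    (extension hC μ).1.weightedNorm ω₂ ≤ (4 * C : ℝ≥0) * μ.1.weightedNorm ω₁ := by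
  refine (weightedNorm_sum_le Finset.univ (fun i : Fin 4 => Complex.I ^ (i : ℕ)) (fun i => by simp)
    _).trans ?_
  -- Each of the four parts is dominated by $|\mu|$ and contributes one factor $C$, whence $4C$.
  calc _ ≤ ∑ _i : Fin 4, C * μ.1.weightedNorm ω₁ := by
        refine Finset.sum_le_sum fun i _ => (weightedNorm_positiveM_le _).trans
          ((lintegral_dilated_le hC _).trans ?_)
        gcongr
        exact lintegral_mono' (μ.1.part_le_variation i) le_rfl
    _ = (4 * C : ℝ≥0) * μ.1.weightedNorm ω₁ := by
        rw [Finset.sum_const, Finset.card_univ, Fintype.card_fin, nsmul_eq_mul]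
        push_cast
        ring

lemma exists_extension_eq (μ : WeightedM ω₁) :
    ∃ (f : WeightedL1 ω₂) (c : ℂ), extension hC μ = ofL1 f + c • diracZero ω₂ := by
  choose f c hfc using fun i => positiveM_eq_ofL1_add
    (lintegral_dilated_lt_top hC (lintegral_part_lt_top μ i))
    (dilated_restrict_absolutelyContinuous _) (dilated_eq_add (μ.1.part i))
  refine ⟨∑ i : Fin 4, Complex.I ^ (i : ℕ) • f i, ∑ i : Fin 4, Complex.I ^ (i : ℕ) * c i, ?_⟩
  have hL : ofL1 (∑ i : Fin 4, Complex.I ^ (i : ℕ) • f i) =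
      ∑ i : Fin 4, Complex.I ^ (i : ℕ) • ofL1 (f i) := by
    refine (map_sum (ofL1LinearMap ω₂) (fun i : Fin 4 => Complex.I ^ (i : ℕ) • f i)
      Finset.univ).trans ?_
    exact Finset.sum_congr rfl fun i _ => (ofL1LinearMap ω₂).map_smul _ (f i)
  rw [hL, Finset.sum_smul, ← Finset.sum_add_distrib]
  refine (Finset.sum_congr rfl fun i _ => ?_ : extensionFun hC μ = _)
  rw [hfc i, smul_add, mul_smul]

end Extension

end HardyCesaro

end


open HardyCesaro in
theorem proposition3p4 (ψ : unitInterval → ℝ≥0) (hψ : AEMeasurable ψ volume) (ω₁ ω₂ : Weight)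
    (hC : ConditionC ψ ω₁ ω₂) :
    (∃! W : WeightedM ω₁ →ₗ[ℂ] WeightedM ω₂, IsMeasureExtension ψ W) ∧
    ∀ W : WeightedM ω₁ →ₗ[ℂ] WeightedM ω₂, IsMeasureExtension ψ W →
      (∃ K : ℝ≥0, ∀ μ : WeightedM ω₁, (W μ).1.weightedNorm ω₂ ≤ K * μ.1.weightedNorm ω₁) ∧
      (∀ U : WeightedL1 ω₁ →L[ℂ] WeightedL1 ω₂, IsHardyCesaro ψ U →
        ∀ f : WeightedL1 ω₁, W (ofL1 f) = ofL1 (U f)) ∧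
      ∀ μ : WeightedM ω₁, ∃! p : WeightedL1 ω₂ × ℂ, W μ = ofL1 p.1 + p.2 • diracZero ω₂ := by
  obtain ⟨C, hC⟩ := hC
  replace hC := lintegral_dilationMeasure_le hψ hC
  have hU₀ := isHardyCesaro_hardyCesaro hψ hC
  -- Any admissible $U$ agrees almost everywhere with the integral formula, which fixes $V$, and $V$
  -- in turn fixes $W$.
  have heq : ∀ W : WeightedM ω₁ →ₗ[ℂ] WeightedM ω₂, IsMeasureExtension ψ W → W = extension hC := by
    rintro W ⟨U, V, hU, hV, hW⟩
    have hVeq : V = restrictedAdjoint hC :=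
      IsRestrictedAdjoint.unique hψ hU hU₀ hV (hU₀.isRestrictedAdjoint hψ hC)
    refine LinearMap.ext fun μ => eq_of_forall_pairing_eq fun g => ?_
    rw [hW g μ, hVeq]
    exact (pairing_extensionFun hC g μ).symm
  refine ⟨⟨extension hC, ⟨hardyCesaro hψ hC, restrictedAdjoint hC, hU₀,
    hU₀.isRestrictedAdjoint hψ hC, pairing_extensionFun hC⟩, heq⟩, fun W hW => ?_⟩
  rw [heq W hW]
  refine ⟨⟨4 * C, weightedNorm_extension_le hC⟩, fun U hU f => ?_, fun μ => ?_⟩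
  -- Tested against $g$, both measures give $\int f\,(V_\psi g)\,dx$.
  · refine eq_of_forall_pairing_eq fun g => ?_
    rw [pairing_ofL1, hU.isRestrictedAdjoint hψ hC f g, ← pairing_ofL1]
    exact pairing_extensionFun hC g _
  · obtain ⟨f, c, hfc⟩ := exists_extension_eq hC μ
    refine ⟨(f, c), hfc, fun p hp => ?_⟩
    obtain ⟨h1, h2⟩ := ofL1_add_smul_diracZero_injective (hp.symm.trans hfc)
    exact Prod.ext h1 h2
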